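/- All graphs are finite and simple. A path on the square grid is a simple path along grid-edges with two distinct endpoints; its interior consists of its points other than the endpoints, and a bend is a 90-degree turn of the path at a grid-point. For $k \ge 0$, a graph $G=(V,E)$ is $B_k$-CPG if there are pairwise interiorly disjoint paths $(P_v)_{v\in V}$ on the grid, each with at most $k$ bends, such that two distinct vertices $u,v$ are adjacent in $G$ if and only if $P_u$ and $P_v$ touch, i.e. have a common grid-point. Let $B_k$-CPG also denote the class of all these graphs. **Corollary.** For every integer $k \ge 0$, $B_k\text{-CPG} \subsetneq B_{k+1}\text{-CPG}$, and this inclusion is strict even within the class of planar graphs: $B_k\text{-CPG} \cap \text{PLANAR} \subsetneq B_{k+1}\text{-CPG} \cap \text{PLANAR}$, where PLANAR is the class of all planar graphs. -/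

import Mathlib

universe u

namespace CPG

/-- The square grid: its grid-points are the integer points of the plane, and two grid-points
are joined by a grid-edge when they are at distance one. -/
def grid : SimpleGraph (ℤ × ℤ) where
  Adj p q := |p.1 - q.1| + |p.2 - q.2| = 1
  symm := ⟨fun p q h => by rw [abs_sub_comm q.1 p.1, abs_sub_comm q.2 p.2]; exact h⟩
  loopless := ⟨fun p h => by simp at h⟩

/-- A path on the grid: a simple path along grid-edges, with two distinct endpoints. -/
structure GridPath where
  src : ℤ × ℤ
  tgt : ℤ × ℤ
  walk : grid.Walk src tgt
  isPath : walk.IsPath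
  src_ne_tgt : src ≠ tgt

namespace GridPath

/-- The grid-points that belong to the path. -/
def points (P : GridPath) : Set (ℤ × ℤ) := {p | p ∈ P.walk.support}

/-- The grid-edges that the path traverses. -/
def edges (P : GridPath) : Set (Sym2 (ℤ × ℤ)) := {e | e ∈ P.walk.edges}

/-- The grid-points of the path other than its endpoints. -/
def interior (P : GridPath) : Set (ℤ × ℤ) := {p ∈ P.points | p ≠ P.src ∧ p ≠ P.tgt}

/-- The number of bends (90-degree turns) of the path. The path turns at its vertex number `i + 1`
exactly when the vertices number `i` and `i + 2` differ in both coordinates. -/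
def numBends (P : GridPath) : ℕ :=
  ((Finset.range (P.walk.length - 1)).filter fun i =>
    (P.walk.getVert i).1 ≠ (P.walk.getVert (i + 2)).1 ∧
    (P.walk.getVert i).2 ≠ (P.walk.getVert (i + 2)).2).card

/-- Two paths on the grid are interiorly disjoint if, as curves in the plane, no interior point of
one is an interior point of the other. As an interior point is either an interior grid-point or a
point inside a grid-edge of the path, this means that they share neither an interior
grid-point nor a grid-edge. -/
def InteriorlyDisjoint (P Q : GridPath) : Prop :=
  Disjoint P.interior Q.interior ∧ Disjoint P.edges Q.edges

/-- Two paths touch if they have a common grid-point. -/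
def Touch (P Q : GridPath) : Prop := (P.points ∩ Q.points).Nonempty

end GridPath

/-- A CPG representation of the graph `G`: pairwise interiorly disjoint paths on the grid, one for
each vertex, such that distinct vertices are adjacent if and only if their paths touch. -/
structure Representation {V : Type u} (G : SimpleGraph V) where
  path : V → GridPath
  disjoint : ∀ u v, u ≠ v → (path u).InteriorlyDisjoint (path v)
  adj_iff : ∀ u v, u ≠ v → (G.Adj u v ↔ (path u).Touch (path v))

/-- `G` is `B_k`-CPG: it has a CPG representation in which every path has at most `k` bends. -/
def IsBCPG {V : Type u} (k : ℕ) (G : SimpleGraph V) : Prop :=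
  ∃ R : Representation G, ∀ v, (R.path v).numBends ≤ k

/-- A drawing of `G` in the plane without crossings: distinct vertices are distinct points, each
edge is an arc joining its two ends, and the interior of the arc of an edge contains no vertex
and no point of the arc of any other edge. -/
structure PlaneDrawing {V : Type u} (G : SimpleGraph V) where
  pt : V → ℝ × ℝ
  pt_injective : Function.Injective pt
  arc : G.edgeSet → C(unitInterval, ℝ × ℝ)
  arc_injective : ∀ e, Function.Injective (arc e)
  arc_ends : ∀ e, ({arc e 0, arc e 1} : Set (ℝ × ℝ)) = pt '' {v | v ∈ e.1}
  arc_interior : ∀ e, ∀ t ∈ Set.Ioo (0 : unitInterval) 1,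
    (∀ v, arc e t ≠ pt v) ∧ ∀ e', e' ≠ e → arc e t ∉ Set.range (arc e')

/-- `G` is planar: it can be drawn in the plane without crossings. -/
def IsPlanar {V : Type u} (G : SimpleGraph V) : Prop := Nonempty (PlaneDrawing G)

/-- A finite simple graph together with its vertex set. -/
structure FinGraph where
  V : Type u
  finite : Finite V
  graph : SimpleGraph V

/-- The class of finite `B_k`-CPG graphs. -/
def BCPG (k : ℕ) : Set FinGraph.{u} := {G | IsBCPG k G.graph}

/-- The class of finite planar graphs. -/
def Planar : Set FinGraph.{u} := {G | IsPlanar G.graph}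

end CPG

namespace CPG

open SimpleGraph

/-! The inclusions are trivial, and `fanGraph (k + 3)` is planar and witnesses both strictnesses.

Lower bound: at a contact of two paths, at least one of them ends. The hub path has only two ends,
so in one of the three copies no gadget contains an end of the hub (`exists_hub_free`). Take a
gadget of this copy that contains no end of the spine either. Each arm must spend one end on the hub
and the other on the spine, and `mid` spends an end on the spine. As the two arms cannot both use
the other end of `mid`, some arm and `mid` end at a common point `p` of the spine
(`exists_common_end`). There all four grid-edges are in use. If the spine were straight at `p`, arm
and `mid` would leave `p` on opposite sides of it, although they are joined through their link. If
other gadgets meet the spine both before and after `p`, then the spine, these two gadgets and the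
hub contain a closed curve through `p` that separates the two sides, a contradiction
(`not_straight`). So a gadget without a bend of the spine is extreme along the spine, and at most
two gadgets are: a spine with `m` gadgets has at least `m - 2` bends (`le_numBends_spine`). The
separation is proved by counting crossings modulo 2 (`not_avoid_closed_walk`).

Upper bound: the spines are parts of one staircase with gadgets at all their corners and ends, so
that `m` gadgets cost exactly `m - 2` bends; all other paths have at most one bend
(`isBCPG_fanGraph`). Planarity is shown by explicit straight-line coordinates (`isPlanar_fanGraph`).
-/

theorem grid_adj_iff {p q : ℤ × ℤ} : grid.Adj p q ↔
    (q.1 = p.1 + 1 ∧ q.2 = p.2) ∨ (q.1 = p.1 - 1 ∧ q.2 = p.2) ∨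
      (q.1 = p.1 ∧ q.2 = p.2 + 1) ∨ (q.1 = p.1 ∧ q.2 = p.2 - 1) := by
  change |p.1 - q.1| + |p.2 - q.2| = 1 ↔ _
  rcases abs_cases (p.1 - q.1) with h | h <;> rcases abs_cases (p.2 - q.2) with h' | h' <;> omega

/-! ### Walks given by sequences, and sums along walks -/

section WalkOf

variable {V : Type*} {G : SimpleGraph V}

/-- The walk that visits `f 0, f 1, …, f L`. -/
def walkOf (f : ℕ → V) : (L : ℕ) → (∀ i < L, G.Adj (f i) (f (i + 1))) → G.Walk (f 0) (f L)
  | 0, _ => .nil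
  | L + 1, h => (walkOf f L fun i hi => h i (by omega)).concat (h L (by omega))

@[simp] theorem length_walkOf (f : ℕ → V) (L : ℕ) (h : ∀ i < L, G.Adj (f i) (f (i + 1))) :
    (walkOf f L h).length = L := by
  induction L with
  | zero => rfl
  | succ L ih => simp [walkOf, ih]

theorem support_walkOf (f : ℕ → V) (L : ℕ) (h : ∀ i < L, G.Adj (f i) (f (i + 1))) :
    (walkOf f L h).support = (List.range (L + 1)).map f := by
  induction L with
  | zero => simp [walkOf]
  | succ L ih =>
    rw [walkOf, Walk.support_concat, ih, List.range_succ (n := L + 1)]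
    simp

theorem mem_support_walkOf {f : ℕ → V} {L : ℕ} {h : ∀ i < L, G.Adj (f i) (f (i + 1))} {v : V} :
    v ∈ (walkOf f L h).support ↔ ∃ i ≤ L, f i = v := by
  simp [support_walkOf]

theorem getVert_walkOf (f : ℕ → V) (L : ℕ) (h : ∀ i < L, G.Adj (f i) (f (i + 1))) {i : ℕ}
    (hi : i ≤ L) : (walkOf f L h).getVert i = f i := by
  rw [Walk.getVert_eq_support_getElem _ (by simpa using hi)]
  simp [support_walkOf]

theorem isPath_walkOf (f : ℕ → V) (L : ℕ) (h : ∀ i < L, G.Adj (f i) (f (i + 1)))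
    (hf : ∀ i j, i ≤ L → j ≤ L → f i = f j → i = j) : (walkOf f L h).IsPath := by
  rw [Walk.isPath_def, support_walkOf]
  refine List.Nodup.map_on ?_ List.nodup_range
  intro a ha b hb hab
  exact hf a b (by simpa [Nat.lt_succ_iff] using ha) (by simpa [Nat.lt_succ_iff] using hb) hab

/-- The sum of a function of the steps of a walk. -/
def walkSum {M : Type*} [AddCommMonoid M] (g : V → V → M) : {a b : V} → G.Walk a b → M
  | _, _, .nil => 0
  | _, _, .cons (u := a) (v := b) _ w => g a b + walkSum g w

theorem walkSum_append {M : Type*} [AddCommMonoid M] (g : V → V → M) {a b c : V}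
    (w : G.Walk a b) (w' : G.Walk b c) :
    walkSum g (w.append w') = walkSum g w + walkSum g w' := by
  induction w with
  | nil => simp [walkSum]
  | cons h w ih => simp [walkSum, ih, add_assoc]

theorem walkSum_walkOf {M : Type*} [AddCommMonoid M] (g : V → V → M) (f : ℕ → V) (L : ℕ)
    (h : ∀ i < L, G.Adj (f i) (f (i + 1))) :
    walkSum g (walkOf f L h) = ∑ i ∈ Finset.range L, g (f i) (f (i + 1)) := by
  induction L with
  | zero => simp [walkSum, walkOf]
  | succ L ih =>
    rw [walkOf, Walk.concat_eq_append, walkSum_append, ih, Finset.sum_range_succ]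
    simp [walkSum]

theorem walkSum_congr {M : Type*} [AddCommMonoid M] {g g' : V → V → M} {a b : V}
    (w : G.Walk a b) (h : ∀ x ∈ w.support, ∀ y ∈ w.support, g x y = g' x y) :
    walkSum g w = walkSum g' w := by
  induction w with
  | nil => rfl
  | cons _ w ih =>
    rw [walkSum, walkSum, h _ (by simp) _ (by simp),
      ih fun x hx y hy => h x (by simp [hx]) y (by simp [hy])]

theorem walkSum_zero {M : Type*} [AddCommMonoid M] {a b : V} (w : G.Walk a b) :
    walkSum (fun _ _ => (0 : M)) w = 0 := by
  induction w with
  | nil => rfl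
  | cons _ w ih => simp [walkSum, ih]

end WalkOf

/-! ### A discrete Jordan curve argument modulo 2 -/

/-- Indicator of a horizontal step between the columns `x` and `x + 1`, above height `y`. -/
def hstep (x y : ℤ) (a b : ℤ × ℤ) : ZMod 2 :=
  if y < a.2 ∧ a.2 = b.2 ∧ ((a.1 = x ∧ b.1 = x + 1) ∨ (a.1 = x + 1 ∧ b.1 = x)) then 1 else 0

/-- Indicator of a step along the vertical grid-edge above `(x, y)`. -/
def vstep (x y : ℤ) (a b : ℤ × ℤ) : ZMod 2 :=
  if a.1 = x ∧ b.1 = x ∧ ((a.2 = y ∧ b.2 = y + 1) ∨ (a.2 = y + 1 ∧ b.2 = y)) then 1 else 0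

/-- Indicator of the open vertical ray above `(x, y)`. -/
def ray (x y : ℤ) (a : ℤ × ℤ) : ZMod 2 := if a.1 = x ∧ y < a.2 then 1 else 0

/-- The three indicators mark the grid-edges that leave the open ray: to the left, to the right and
through its lower end. A step uses one of them exactly when it enters or leaves the ray. -/
theorem hstep_add_vstep (x y : ℤ) {a b : ℤ × ℤ} (h : grid.Adj a b) :
    hstep (x - 1) y a b + hstep x y a b + vstep x y a b = ray x y a + ray x y b := by
  rw [grid_adj_iff] at h
  have h2 : (1 : ZMod 2) + 1 = 0 := by decide
  unfold hstep vstep ray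
  split_ifs <;> first | (exfalso; omega) | simp [h2]

theorem walkSum_hstep_add_vstep (x y : ℤ) {a b : ℤ × ℤ} (w : grid.Walk a b) :
    walkSum (hstep (x - 1) y) w + walkSum (hstep x y) w + walkSum (vstep x y) w =
      ray x y a + ray x y b := by
  induction w with
  | nil => simp [walkSum, CharTwo.add_self_eq_zero]
  | @cons a c b h w ih =>
    have h1 := hstep_add_vstep x y h
    have h2 : ray x y c + ray x y c = 0 := CharTwo.add_self_eq_zero _
    simp only [walkSum]
    linear_combination ih + h1 + h2

theorem walkSum_hstep_closed (x y : ℤ) {a : ℤ × ℤ} (w : grid.Walk a a) :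
    walkSum (hstep (x - 1) y) w = walkSum (hstep x y) w + walkSum (vstep x y) w := by
  have h := walkSum_hstep_add_vstep x y w
  rw [CharTwo.add_self_eq_zero, add_assoc] at h
  exact CharTwo.add_eq_zero.mp h

theorem walkSum_vstep_eq_zero {x y : ℤ} {a b : ℤ × ℤ} (w : grid.Walk a b)
    (h : (x, y) ∉ w.support) : walkSum (vstep x y) w = 0 := by
  rw [← walkSum_zero w]
  refine walkSum_congr w fun s hs t ht => if_neg ?_
  rintro ⟨h1, h2, h3 | h3⟩
  · exact h (by rwa [← h1, ← h3.1])
  · exact h (by rwa [← h2, ← h3.2])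

/-- Raising the base of the ray loses only the steps at height `y + 1`, and each of these has `(x, y
+ 1)` as an end. -/
theorem walkSum_hstep_up {x y : ℤ} {a b : ℤ × ℤ} (w : grid.Walk a b)
    (h : (x, y + 1) ∉ w.support) :
    walkSum (hstep x (y + 1)) w = walkSum (hstep x y) w := by
  refine walkSum_congr w fun s hs t ht => ?_
  have h1 : ¬ (s.1 = x ∧ s.2 = y + 1) := fun h' => h (by rwa [← h'.1, ← h'.2])
  have h2 : ¬ (t.1 = x ∧ t.2 = y + 1) := fun h' => h (by rwa [← h'.1, ← h'.2])
  unfold hstep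
  split_ifs <;> first | rfl | (exfalso; omega)

/-- The sum is the parity of the crossings of `D` with an upward ray just to the right of the point,
a winding number modulo 2. Off `D` it survives horizontal steps by `walkSum_hstep_closed` and
vertical ones by `walkSum_hstep_up`. -/
theorem walkSum_hstep_const {a : ℤ × ℤ} (D : grid.Walk a a) {q r : ℤ × ℤ} (w : grid.Walk q r)
    (h : ∀ z ∈ w.support, z ∉ D.support) :
    walkSum (hstep q.1 q.2) D = walkSum (hstep r.1 r.2) D := by
  induction w with
  | nil => rfl
  | @cons s t b hst w ih =>
    rw [← ih fun z hz => h z (by simp [hz])]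
    have hs : (s.1, s.2) ∉ D.support := h s (by simp)
    have ht : (t.1, t.2) ∉ D.support := h t (by simp)
    rcases grid_adj_iff.mp hst with ⟨h1, h2⟩ | ⟨h1, h2⟩ | ⟨h1, h2⟩ | ⟨h1, h2⟩
    · have := walkSum_hstep_closed t.1 t.2 D
      rw [walkSum_vstep_eq_zero D ht, add_zero] at this
      rw [← this, h1, h2, add_sub_cancel_right]
    · have := walkSum_hstep_closed s.1 s.2 D
      rw [walkSum_vstep_eq_zero D hs, add_zero] at this
      rw [← this, h1, h2]
    · rw [h1, h2] at ht ⊢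
      exact (walkSum_hstep_up D ht).symm
    · have h3 : s.2 = t.2 + 1 := by omega
      rw [h3, ← h1] at hs
      rw [h3, ← h1]
      exact walkSum_hstep_up D hs

/-- A closed walk that passes once along the grid-edge above `p` separates the left from the right
neighbour of `p`. -/
theorem not_avoid_closed_walk {a p q r : ℤ × ℤ} (D : grid.Walk a a)
    (hD : walkSum (vstep p.1 p.2) D = 1) (hq : q = (p.1 - 1, p.2)) (hr : r = (p.1 + 1, p.2))
    (w : grid.Walk q r) (h : ∀ z ∈ w.support, z ∉ D.support) : False := by
  have h1 := walkSum_hstep_const D w h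
  have h2 := walkSum_hstep_closed p.1 p.2 D
  have h3 := walkSum_hstep_closed (p.1 + 1) p.2 D
  rw [walkSum_vstep_eq_zero D (hr ▸ h r (by simp)), add_zero, add_sub_cancel_right] at h3
  rw [hq, hr] at h1
  simp only at h1
  rw [h1, hD, h3] at h2
  simp at h2

/-- An injective sequence runs along a grid-edge at most once, in either direction. -/
theorem sum_vstep_eq_one {x y : ℤ} {f : ℕ → ℤ × ℤ} {L k : ℕ}
    (hinj : ∀ i j, i ≤ L → j ≤ L → f i = f j → i = j) (hk : k < L)
    (h1 : (f k).1 = x) (h2 : (f (k + 1)).1 = x)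
    (h3 : ((f k).2 = y ∧ (f (k + 1)).2 = y + 1) ∨ ((f k).2 = y + 1 ∧ (f (k + 1)).2 = y)) :
    ∑ i ∈ Finset.range L, vstep x y (f i) (f (i + 1)) = 1 := by
  rw [Finset.sum_eq_single_of_mem k (Finset.mem_range.mpr hk)]
  · exact if_pos ⟨h1, h2, h3⟩
  · intro i hi hik
    rw [Finset.mem_range] at hi
    refine if_neg ?_
    rintro ⟨h4, h5, h6⟩
    have key : (f i = f k ∧ f (i + 1) = f (k + 1)) ∨ (f i = f (k + 1) ∧ f (i + 1) = f k) := by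
      simp only [Prod.ext_iff]
      omega
    rcases key with ⟨h, _⟩ | ⟨h, h'⟩
    · exact hik (hinj _ _ hi.le hk.le h)
    · have := hinj _ _ hi.le hk h
      have := hinj _ _ hi hk.le h'
      omega

/-- The sequence occupies the grid-points above and below `f t`, so `q` and `r` are its left and
right neighbours, which the closed walk separates. -/
theorem not_avoid_of_vertical {f : ℕ → ℤ × ℤ} {a b t : ℕ}
    (hadj : ∀ i, a ≤ i → i < b → grid.Adj (f i) (f (i + 1)))
    (hinj : ∀ i j, a ≤ i → i ≤ b → a ≤ j → j ≤ b → f i = f j → i = j)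
    (hat : a < t) (htb : t < b) (hv : (f (t - 1)).1 = (f (t + 1)).1)
    (rest : grid.Walk (f b) (f a)) (hrest : f t ∉ rest.support)
    {q r : ℤ × ℤ} (hq : grid.Adj (f t) q) (hr : grid.Adj (f t) r) (hqr : q ≠ r)
    (w : grid.Walk q r) (hw : ∀ z ∈ w.support, z ∉ rest.support)
    (hwf : ∀ i, a ≤ i → i ≤ b → f i ∉ w.support) : False := by
  obtain ⟨L, rfl⟩ : ∃ L, b = a + L := ⟨b - a, by omega⟩
  let seg : grid.Walk (f (a + 0)) (f (a + L)) :=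
    walkOf (fun i => f (a + i)) L fun i hi => hadj (a + i) (by omega) (by omega)
  have h1 := hadj (t - 1) (by omega) (by omega)
  have h2 := hadj t (by omega) (by omega)
  rw [Nat.sub_add_cancel (by omega)] at h1
  have hne : f (t - 1) ≠ f (t + 1) := fun h => by
    have := hinj _ _ (by omega) (by omega) (by omega) (by omega) h
    omega
  have hne' : ¬ ((f (t - 1)).1 = (f (t + 1)).1 ∧ (f (t - 1)).2 = (f (t + 1)).2) :=
    fun h => hne (Prod.ext h.1 h.2)
  have hqt1 : q ≠ f (t - 1) := fun h => hwf (t - 1) (by omega) (by omega) (h ▸ w.start_mem_support)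
  have hqt2 : q ≠ f (t + 1) := fun h => hwf (t + 1) (by omega) (by omega) (h ▸ w.start_mem_support)
  have hrt1 : r ≠ f (t - 1) := fun h => hwf (t - 1) (by omega) (by omega) (h ▸ w.end_mem_support)
  have hrt2 : r ≠ f (t + 1) := fun h => hwf (t + 1) (by omega) (by omega) (h ▸ w.end_mem_support)
  rw [ne_eq, Prod.ext_iff] at hqt1 hqt2 hrt1 hrt2 hqr
  rw [grid_adj_iff] at h1 h2 hq hr
  -- Exactly one of the two steps at `f t`, the entering or the leaving one, uses the grid-edge
  -- above `f t`; `rest` misses `f t` and contributes nothing.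
  have hsum : walkSum (vstep (f t).1 (f t).2) (seg.append rest) = 1 := by
    rw [walkSum_append, walkSum_vstep_eq_zero rest hrest, add_zero, walkSum_walkOf]
    have hinj' : ∀ i j, i ≤ L → j ≤ L → f (a + i) = f (a + j) → i = j := fun i j hi hj h => by
      have := hinj _ _ (by omega) (by omega) (by omega) (by omega) h
      omega
    have ht0 : a + (t - a) = t := by omega
    have ht1 : a + (t - a + 1) = t + 1 := by omega
    have ht2 : a + (t - 1 - a) = t - 1 := by omega
    have ht3 : a + (t - 1 - a + 1) = t := by omega
    have hc : (f t).1 = (f (t + 1)).1 ∧ (f t).1 = (f (t - 1)).1 ∧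
        ((f (t + 1)).2 = (f t).2 + 1 ∨ (f (t - 1)).2 = (f t).2 + 1) := by
      clear hq hr hqt1 hqt2 hrt1 hrt2 hqr
      omega
    obtain ⟨hc1, hc2, hc | hc⟩ := hc
    · refine sum_vstep_eq_one (f := fun i => f (a + i)) hinj' (k := t - a) (by omega) ?_ ?_ ?_ <;>
        simp only [ht0, ht1, hc, hc1, true_or, and_self]
    · refine sum_vstep_eq_one (f := fun i => f (a + i)) hinj' (k := t - 1 - a) (by omega)
        ?_ ?_ ?_ <;>
        simp only [ht2, ht3, hc, hc2, or_true, and_self]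
  have hD : ∀ z ∈ w.support, z ∉ (seg.append rest).support := by
    intro z hz hz'
    rcases Walk.mem_support_append_iff _ _ |>.mp hz' with h | h
    · obtain ⟨i, hi, rfl⟩ := mem_support_walkOf.mp h
      exact hwf (a + i) (by omega) (by omega) hz
    · exact hw z hz h
  have hqr' : (q = ((f t).1 - 1, (f t).2) ∧ r = ((f t).1 + 1, (f t).2)) ∨
      (r = ((f t).1 - 1, (f t).2) ∧ q = ((f t).1 + 1, (f t).2)) := by
    simp only [Prod.ext_iff]
    have hc : (f t).1 = (f (t + 1)).1 ∧ (f t).1 = (f (t - 1)).1 ∧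
        ((f (t + 1)).2 = (f t).2 + 1 ∧ (f (t - 1)).2 = (f t).2 - 1 ∨
          (f (t + 1)).2 = (f t).2 - 1 ∧ (f (t - 1)).2 = (f t).2 + 1) := by
      clear hq hr hqt1 hqt2 hrt1 hrt2 hqr
      omega
    clear h1 h2 hne'
    have hq' : q = ((f t).1 - 1, (f t).2) ∨ q = ((f t).1 + 1, (f t).2) := by
      simp only [Prod.ext_iff]
      clear hr hrt1 hrt2 hqr
      omega
    have hr' : r = ((f t).1 - 1, (f t).2) ∨ r = ((f t).1 + 1, (f t).2) := by
      simp only [Prod.ext_iff]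
      clear hq hq' hqt1 hqt2 hqr
      omega
    simp only [Prod.ext_iff] at hq' hr'
    clear hq hr hqt1 hqt2 hrt1 hrt2 hc
    omega
  rcases hqr' with ⟨hq', hr'⟩ | ⟨hr', hq'⟩
  · exact not_avoid_closed_walk (seg.append rest) hsum hq' hr' w hD
  · exact not_avoid_closed_walk (seg.append rest) hsum hr' hq' w.reverse (by simpa using hD)

/-- The reflection of the grid in the diagonal. -/
def swapHom : grid →g grid where
  toFun := Prod.swap
  map_rel' := by
    intro a b h
    rw [grid_adj_iff] at h ⊢
    simp only [Prod.fst_swap, Prod.snd_swap]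
    omega

theorem not_avoid_of_straight {f : ℕ → ℤ × ℤ} {a b t : ℕ}
    (hadj : ∀ i, a ≤ i → i < b → grid.Adj (f i) (f (i + 1)))
    (hinj : ∀ i j, a ≤ i → i ≤ b → a ≤ j → j ≤ b → f i = f j → i = j)
    (hat : a < t) (htb : t < b)
    (hv : (f (t - 1)).1 = (f (t + 1)).1 ∨ (f (t - 1)).2 = (f (t + 1)).2)
    (rest : grid.Walk (f b) (f a)) (hrest : f t ∉ rest.support)
    {q r : ℤ × ℤ} (hq : grid.Adj (f t) q) (hr : grid.Adj (f t) r) (hqr : q ≠ r)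
    (w : grid.Walk q r) (hw : ∀ z ∈ w.support, z ∉ rest.support)
    (hwf : ∀ i, a ≤ i → i ≤ b → f i ∉ w.support) : False := by
  rcases hv with hv | hv
  · exact not_avoid_of_vertical hadj hinj hat htb hv rest hrest hq hr hqr w hw hwf
  · have hs : ∀ z, swapHom z = z.swap := fun _ => rfl
    refine not_avoid_of_vertical (f := fun i => swapHom (f i)) (a := a) (b := b) (t := t)
      (fun i h1 h2 => swapHom.map_adj (hadj i h1 h2))
      (fun i j h1 h2 h3 h4 h => hinj i j h1 h2 h3 h4 (Prod.swap_injective h)) hat htb hv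
      (rest.map swapHom) ?_ (swapHom.map_adj hq) (swapHom.map_adj hr)
      (fun h => hqr (Prod.swap_injective h)) (w.map swapHom) ?_ ?_
    · simp only [Walk.support_map, List.mem_map, hs, not_exists, not_and]
      intro z hz h
      exact hrest (Prod.swap_injective h ▸ hz)
    · intro z' hz h
      simp only [Walk.support_map, List.mem_map, hs] at hz h
      obtain ⟨z, hz, rfl⟩ := hz
      obtain ⟨z', hz', h⟩ := h
      exact hw z hz (Prod.swap_injective h ▸ hz')
    · simp only [Walk.support_map, List.mem_map, hs, not_exists, not_and]
      intro i h1 h2 z' hz' h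
      exact hwf i h1 h2 (Prod.swap_injective h ▸ hz')

/-! ### The separating graph -/

open SimpleGraph

/-- The vertices of the graph `fanGraph m`. -/
inductive FanVertex (m : ℕ) : Type u
  | hub
  | spine (i : Fin 3)
  | arm (b : Bool) (i : Fin 3) (j : Fin m)
  | mid (i : Fin 3) (j : Fin m)
  | link (b : Bool) (i : Fin 3) (j : Fin m)

namespace FanVertex

variable {m : ℕ}

theorem finite (m : ℕ) : Finite (FanVertex.{u} m) := by
  let f : FanVertex.{u} m →
      Fin 5 × Option Bool × Option (Fin 3) × Option (Fin m) := fun v =>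
    match v with
    | hub => (0, none, none, none)
    | spine i => (1, none, some i, none)
    | arm b i j => (2, some b, some i, some j)
    | mid i j => (3, none, some i, some j)
    | link b i j => (4, some b, some i, some j)
  refine Finite.of_injective f ?_
  rintro (_ | _ | _ | _ | _) (_ | _ | _ | _ | _) h <;> simp_all [f]

/-- The edges of `fanGraph m`, each in one of its two orientations. -/
inductive Joined : FanVertex.{u} m → FanVertex.{u} m → Prop
  | arm_hub (b i j) : Joined (arm b i j) hub
  | arm_spine (b i j) : Joined (arm b i j) (spine i)
  | mid_spine (i j) : Joined (mid i j) (spine i)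
  | arm_mid (b i j) : Joined (arm b i j) (mid i j)
  | link_mid (b i j) : Joined (link b i j) (mid i j)
  | link_arm (b i j) : Joined (link b i j) (arm b i j)

theorem Joined.ne {v w : FanVertex.{u} m} (h : Joined v w) : v ≠ w := by
  cases h <;> simp

end FanVertex

open FanVertex

/-- Three copies of the following graph share their hub: `m` gadgets, each of which is a path
`arm`, `mid`, `arm` whose vertices are adjacent to the spine and whose ends are adjacent to the
hub, together with one more common neighbour (`link`) of the ends of each edge of the path. -/
def fanGraph (m : ℕ) : SimpleGraph (FanVertex.{u} m) where
  Adj v w := Joined v w ∨ Joined w v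
  symm := ⟨fun _ _ h => h.symm⟩
  loopless := ⟨fun _ h => h.elim (fun h => h.ne rfl) fun h => h.ne rfl⟩

theorem fanGraph_adj {m : ℕ} {v w : FanVertex.{u} m} :
    (fanGraph m).Adj v w ↔ Joined v w ∨ Joined w v := Iff.rfl

/-! ### Ends of grid paths and contacts in a representation -/

namespace GridPath

/-- `z` is one of the two endpoints of `P`. -/
def IsEnd (P : GridPath) (z : ℤ × ℤ) : Prop := z = P.src ∨ z = P.tgt

theorem IsEnd.mem {P : GridPath} {z : ℤ × ℤ} (h : P.IsEnd z) : z ∈ P.points := by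
  rcases h with rfl | rfl
  · exact P.walk.start_mem_support
  · exact P.walk.end_mem_support

theorem IsEnd.eq_of_ne {P : GridPath} {x y z : ℤ × ℤ} (hx : P.IsEnd x) (hy : P.IsEnd y)
    (hz : P.IsEnd z) (hxz : x ≠ z) (hyz : y ≠ z) : x = y := by
  have := P.src_ne_tgt
  rcases hx with rfl | rfl <;> rcases hy with rfl | rfl <;> rcases hz with rfl | rfl <;> simp_all

theorem InteriorlyDisjoint.isEnd {P Q : GridPath} (h : P.InteriorlyDisjoint Q) {z : ℤ × ℤ}
    (hP : z ∈ P.points) (hQ : z ∈ Q.points) : P.IsEnd z ∨ Q.IsEnd z := by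
  by_contra! hc
  simp only [IsEnd, not_or] at hc
  exact Set.disjoint_left.mp h.1 ⟨hP, hc.1.1, hc.1.2⟩ ⟨hQ, hc.2.1, hc.2.2⟩

theorem exists_walk (P : GridPath) {x y : ℤ × ℤ} (hx : x ∈ P.points) (hy : y ∈ P.points) :
    ∃ w : grid.Walk x y, ∀ z ∈ w.support, z ∈ P.points := by
  refine ⟨(P.walk.takeUntil x hx).reverse.append (P.walk.takeUntil y hy), fun z hz => ?_⟩
  rcases Walk.mem_support_append_iff _ _ |>.mp hz with h | h
  · rw [Walk.support_reverse, List.mem_reverse] at h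
    exact P.walk.support_takeUntil_subset_support hx h
  · exact P.walk.support_takeUntil_subset_support hy h

end GridPath

/-- The first grid-edge records the direction in which the path leaves `p`. The last clause keeps
the rest of the walk away from the other end `e`, hence from contacts that can only occur at ends,
except possibly at `x` itself. -/
theorem exists_strand {p e x : ℤ × ℤ} (c : grid.Walk p e) (hc : c.IsPath) (hx : x ∈ c.support)
    (hxp : x ≠ p) : ∃ q, grid.Adj p q ∧ s(p, q) ∈ c.edges ∧
      ∃ w : grid.Walk q x, ∀ z ∈ w.support, z ∈ c.support ∧ z ≠ p ∧ (z = e → z = x) := by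
  cases c with
  | nil => simp_all
  | @cons _ q _ h c =>
    have hx' : x ∈ c.support := by simpa [hxp] using hx
    rw [Walk.cons_isPath_iff] at hc
    refine ⟨q, h, by simp, c.takeUntil x hx', fun z hz => ?_⟩
    have hz' := c.support_takeUntil_subset_support hx' hz
    refine ⟨by simp [hz'], fun h => hc.2 (h ▸ hz'), ?_⟩
    rintro rfl
    by_contra hzx
    exact Walk.endpoint_notMem_support_takeUntil hc.1 hx' hzx hz

theorem GridPath.IsEnd.exists_strand {c : GridPath} {p x : ℤ × ℤ} (hp : c.IsEnd p)
    (hx : x ∈ c.points) (hxp : x ≠ p) : ∃ q, grid.Adj p q ∧ s(p, q) ∈ c.edges ∧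
      ∃ w : grid.Walk q x, ∀ z ∈ w.support, z ∈ c.points ∧ z ≠ p ∧ (c.IsEnd z → z = x) := by
  rcases hp with rfl | rfl
  · obtain ⟨q, h1, h2, w, hw⟩ := CPG.exists_strand c.walk c.isPath hx hxp
    refine ⟨q, h1, h2, w, fun z hz => ⟨(hw z hz).1, (hw z hz).2.1, fun h => ?_⟩⟩
    exact (hw z hz).2.2 (h.resolve_left (hw z hz).2.1)
  · obtain ⟨q, h1, h2, w, hw⟩ := CPG.exists_strand c.walk.reverse c.isPath.reverse
      (x := x)
      (by simpa [GridPath.points] using hx) hxp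
    refine ⟨q, h1, by simpa [GridPath.edges] using h2, w, fun z hz => ?_⟩
    have := hw z hz
    exact ⟨by simpa [GridPath.points] using this.1, this.2.1, fun h => this.2.2 (h.resolve_right this.2.1)⟩

theorem Representation.exists_common {V : Type u} {G : SimpleGraph V} (R : Representation G)
    {v w : V} (h : G.Adj v w) : ∃ z, z ∈ (R.path v).points ∧ z ∈ (R.path w).points :=
  (R.adj_iff v w h.ne).mp h

namespace Representation

variable {V : Type u} {G : SimpleGraph V} (R : Representation G)

theorem isEnd_or {v w : V} (h : v ≠ w) {z : ℤ × ℤ} (hv : z ∈ (R.path v).points)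
    (hw : z ∈ (R.path w).points) : (R.path v).IsEnd z ∨ (R.path w).IsEnd z :=
  (R.disjoint v w h).isEnd hv hw

theorem adj_of_mem {v w : V} (h : v ≠ w) {z : ℤ × ℤ} (hv : z ∈ (R.path v).points)
    (hw : z ∈ (R.path w).points) : G.Adj v w :=
  (R.adj_iff v w h).mpr ⟨z, hv, hw⟩

end Representation

/-! ### Lower bound on the bends of a spine -/

section LowerBound

variable {m : ℕ} (R : Representation (fanGraph.{u} m))

/-- The points of the three paths `arm`, `mid`, `arm` of a gadget. -/
def bundle (i : Fin 3) (j : Fin m) : Set (ℤ × ℤ) :=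
  {z | z ∈ (R.path (mid i j)).points ∨ ∃ b, z ∈ (R.path (arm b i j)).points}

/-- No edge joins the arms and middle vertices of different gadgets. -/
theorem bundle_disjoint {i i' : Fin 3} {j j' : Fin m} {z : ℤ × ℤ} (h : z ∈ bundle R i j)
    (h' : z ∈ bundle R i' j') : i = i' ∧ j = j' := by
  by_contra hne
  rcases h with h | ⟨b, h⟩ <;> rcases h' with h' | ⟨b', h'⟩
  all_goals
    have := R.adj_of_mem (by simp <;> tauto) h h'
    rcases this with this | this <;> cases this <;> simp at hne

theorem exists_walk_to_hub {i : Fin 3} {j : Fin m} {z : ℤ × ℤ} (h : z ∈ bundle R i j) :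
    ∃ z' ∈ (R.path hub).points, ∃ w : grid.Walk z z', ∀ y ∈ w.support, y ∈ bundle R i j := by
  have key : ∀ b z, z ∈ (R.path (arm b i j)).points →
      ∃ z' ∈ (R.path hub).points, ∃ w : grid.Walk z z', ∀ y ∈ w.support, y ∈ bundle R i j := by
    intro b z hz
    obtain ⟨z', h1, h2⟩ := R.exists_common (Or.inl (.arm_hub b i j))
    obtain ⟨w, hw⟩ := (R.path (arm b i j)).exists_walk hz h1
    exact ⟨z', h2, w, fun y hy => Or.inr ⟨b, hw y hy⟩⟩
  rcases h with h | ⟨b, h⟩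
  · obtain ⟨x, h1, h2⟩ := R.exists_common (Or.inl (.arm_mid false i j))
    obtain ⟨w, hw⟩ := (R.path (mid i j)).exists_walk h h2
    obtain ⟨z', hz', w', hw'⟩ := key false x h1
    refine ⟨z', hz', w.append w', fun y hy => ?_⟩
    rcases Walk.mem_support_append_iff _ _ |>.mp hy with hy | hy
    · exact Or.inl (hw y hy)
    · exact hw' y hy
  · exact key b z h

/-- If no end of the hub or of the spine lies on a gadget, then `mid` and one of the two `arm`s
of the gadget end at the same point of the spine. -/
theorem exists_common_end {i : Fin 3} {j : Fin m}
    (hH : ∀ z ∈ bundle R i j, ¬ (R.path hub).IsEnd z)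
    (hU : ∀ z ∈ bundle R i j, ¬ (R.path (spine i)).IsEnd z) :
    ∃ b, ∃ p ∈ (R.path (spine i)).points, (R.path (arm b i j)).IsEnd p ∧
      (R.path (mid i j)).IsEnd p := by
  by_contra! hc
  have harm : ∀ b z, z ∈ (R.path (arm b i j)).points → z ∈ (R.path (spine i)).points →
      (R.path (arm b i j)).IsEnd z := fun b z h1 h2 =>
    (R.isEnd_or (by simp) h1 h2).resolve_right (hU z (Or.inr ⟨b, h1⟩))
  have hmid : ∀ z, z ∈ (R.path (mid i j)).points → z ∈ (R.path (spine i)).points →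
      (R.path (mid i j)).IsEnd z := fun z h1 h2 =>
    (R.isEnd_or (by simp) h1 h2).resolve_right (hU z (Or.inl h1))
  obtain ⟨e, he1, he2⟩ := R.exists_common (Or.inl (.mid_spine i j))
  have he := hmid e he1 he2
  -- Both ends of an arm are spent, on the hub and on the spine. Its contact with `mid` is not at
  -- the first end, since `mid` misses the hub, nor at the second, by the assumption `hc`; so it is
  -- the end of `mid` other than `e`.
  have key : ∀ b, ∃ g ∈ (R.path (arm b i j)).points, (R.path (mid i j)).IsEnd g ∧ g ≠ e := by
    intro b
    obtain ⟨x, hx1, hx2⟩ := R.exists_common (Or.inl (.arm_spine b i j))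
    obtain ⟨r, hr1, hr2⟩ := R.exists_common (Or.inl (.arm_hub b i j))
    have hx := harm b x hx1 hx2
    have hr := (R.isEnd_or (by simp) hr1 hr2).resolve_right (hH r (Or.inr ⟨b, hr1⟩))
    have hxr : r ≠ x := by
      rintro rfl
      rcases R.adj_of_mem (by simp) hx2 hr2 with h | h <;> cases h
    obtain ⟨z, hz1, hz2⟩ := R.exists_common (Or.inl (.arm_mid b i j))
    have hzx : z ≠ x := by
      rintro rfl
      exact hc b z hx2 hx (hmid z hz2 hx2)
    have hzend : (R.path (mid i j)).IsEnd z := by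
      refine (R.isEnd_or (by simp) hz1 hz2).resolve_left fun hz => ?_
      obtain rfl := hz.eq_of_ne hr hx hzx hxr
      rcases R.adj_of_mem (by simp) hz2 hr2 with h | h <;> cases h
    refine ⟨z, hz1, hzend, ?_⟩
    rintro rfl
    exact hc b z he2 (harm b z hz1 he2) he
  -- `mid` has only one end besides `e`, so the two arms would meet there, but they are not
  -- adjacent.
  obtain ⟨g, hg1, hg2, hg3⟩ := key false
  obtain ⟨g', hg1', hg2', hg3'⟩ := key true
  obtain rfl := hg2.eq_of_ne hg2' he hg3 hg3'
  rcases R.adj_of_mem (by simp) hg1 hg1' with h | h <;> cases h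

/-- A spine that is straight at a common end `p` of two paths of a gadget meets the
other gadgets on one side of `p` only. -/
theorem not_straight {i : Fin 3} {j : Fin m}
    (hH : ∀ z ∈ bundle R i j, ¬ (R.path hub).IsEnd z)
    (hU : ∀ z ∈ bundle R i j, ¬ (R.path (spine i)).IsEnd z) {β : Bool} {t : ℕ}
    (harm : (R.path (arm β i j)).IsEnd ((R.path (spine i)).walk.getVert t))
    (hmid : (R.path (mid i j)).IsEnd ((R.path (spine i)).walk.getVert t))
    (hv : ((R.path (spine i)).walk.getVert (t - 1)).1 =
        ((R.path (spine i)).walk.getVert (t + 1)).1 ∨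
      ((R.path (spine i)).walk.getVert (t - 1)).2 =
        ((R.path (spine i)).walk.getVert (t + 1)).2)
    {j₁ j₂ : Fin m} (hj₁ : j₁ ≠ j) (hj₂ : j₂ ≠ j) {a b : ℕ} (hat : a < t) (htb : t < b)
    (hb : b ≤ (R.path (spine i)).walk.length)
    (h₁ : (R.path (spine i)).walk.getVert a ∈ bundle R i j₁)
    (h₂ : (R.path (spine i)).walk.getVert b ∈ bundle R i j₂) : False := by
  have hmem : ∀ k, (R.path (spine i)).walk.getVert k ∈ (R.path (spine i)).points :=
    fun k => Walk.getVert_mem_support _ k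
  -- The closed curve follows the spine from `a` to `b` and returns through gadget `j₂`, the hub and
  -- gadget `j₁`.
  obtain ⟨y₁, hy₁, w₁, hw₁⟩ := exists_walk_to_hub R h₁
  obtain ⟨y₂, hy₂, w₂, hw₂⟩ := exists_walk_to_hub R h₂
  obtain ⟨wh, hwh⟩ := (R.path hub).exists_walk hy₂ hy₁
  have hrest : ∀ z ∈ (w₂.append (wh.append w₁.reverse)).support,
      z ∈ (R.path hub).points ∨ ∃ j', j' ≠ j ∧ z ∈ bundle R i j' := by
    intro z hz
    simp only [Walk.mem_support_append_iff, Walk.support_reverse, List.mem_reverse] at hz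
    rcases hz with hz | hz | hz
    · exact Or.inr ⟨j₂, hj₂, hw₂ z hz⟩
    · exact Or.inl (hwh z hz)
    · exact Or.inr ⟨j₁, hj₁, hw₁ z hz⟩
  obtain ⟨x, hx, hxl⟩ := R.exists_common (Or.inr (.link_arm β i j))
  obtain ⟨x', hx', hxl'⟩ := R.exists_common (Or.inr (.link_mid β i j))
  have hlinkU : ∀ z ∈ (R.path (link β i j)).points, z ∉ (R.path (spine i)).points := by
    intro z h h'
    rcases R.adj_of_mem (by simp) h h' with h | h <;> cases h
  have hlinkH : ∀ z ∈ (R.path (link β i j)).points, z ∉ (R.path hub).points := by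
    intro z h h'
    rcases R.adj_of_mem (by simp) h h' with h | h <;> cases h
  have hlinkB : ∀ z ∈ (R.path (link β i j)).points, ∀ j' ≠ j, z ∉ bundle R i j' := by
    rintro z h j' hj' (h' | ⟨b, h'⟩)
    all_goals
      rcases R.adj_of_mem (by simp) h h' with h | h <;> cases h
      exact hj' rfl
  -- The two strands leave the common end by different grid-edges and are joined through the link. A
  -- strand could touch the spine or the hub only at an end of its own path, hence only at its
  -- contact with the link, which misses both.
  obtain ⟨q, hq, hqe, s, hs⟩ := harm.exists_strand hx fun h => hlinkU x hxl (h ▸ hmem t)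
  obtain ⟨q', hq', hqe', s', hs'⟩ := hmid.exists_strand hx' fun h => hlinkU x' hxl' (h ▸ hmem t)
  obtain ⟨wl, hwl⟩ := (R.path (link β i j)).exists_walk hxl hxl'
  have hsU : ∀ z ∈ s.support, z ∈ bundle R i j ∧ z ∉ (R.path (spine i)).points ∧
      z ∉ (R.path hub).points := by
    intro z hz
    obtain ⟨h1, -, h2⟩ := hs z hz
    have hB : z ∈ bundle R i j := Or.inr ⟨_, h1⟩
    refine ⟨hB, fun h => ?_, fun h => ?_⟩
    · obtain rfl := h2 ((R.isEnd_or (by simp) h1 h).resolve_right (hU z hB))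
      exact hlinkU z hxl h
    · obtain rfl := h2 ((R.isEnd_or (by simp) h1 h).resolve_right (hH z hB))
      exact hlinkH z hxl h
  have hsU' : ∀ z ∈ s'.support, z ∈ bundle R i j ∧ z ∉ (R.path (spine i)).points ∧
      z ∉ (R.path hub).points := by
    intro z hz
    obtain ⟨h1, -, h2⟩ := hs' z hz
    have hB : z ∈ bundle R i j := Or.inl h1
    refine ⟨hB, fun h => ?_, fun h => ?_⟩
    · obtain rfl := h2 ((R.isEnd_or (by simp) h1 h).resolve_right (hU z hB))
      exact hlinkU z hxl' h
    · obtain rfl := h2 ((R.isEnd_or (by simp) h1 h).resolve_right (hH z hB))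
      exact hlinkH z hxl' h
  have hqq' : q ≠ q' := by
    rintro rfl
    exact Set.disjoint_left.mp (R.disjoint (arm β i j) (mid i j) (by simp)).2 hqe hqe'
  have hw : ∀ z ∈ (s.append (wl.append s'.reverse)).support,
      z ∉ (R.path (spine i)).points ∧ z ∉ (R.path hub).points ∧
        ∀ j' ≠ j, z ∉ bundle R i j' := by
    intro z hz
    simp only [Walk.mem_support_append_iff, Walk.support_reverse, List.mem_reverse] at hz
    rcases hz with hz | hz | hz
    · exact ⟨(hsU z hz).2.1, (hsU z hz).2.2,
        fun j' hj' h => hj' (bundle_disjoint R h (hsU z hz).1).2⟩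
    · exact ⟨hlinkU z (hwl z hz), hlinkH z (hwl z hz), hlinkB z (hwl z hz)⟩
    · exact ⟨(hsU' z hz).2.1, (hsU' z hz).2.2,
        fun j' hj' h => hj' (bundle_disjoint R h (hsU' z hz).1).2⟩
  have hinj := (R.path (spine i)).isPath.getVert_injOn
  refine not_avoid_of_straight (f := (R.path (spine i)).walk.getVert) (a := a) (b := b) (t := t)
    (fun k _ h => Walk.adj_getVert_succ _ (by omega))
    (fun k l _ h _ h' e => hinj (show k ≤ _ by omega) (show l ≤ _ by omega) e) hat htb hv
    (w₂.append (wh.append w₁.reverse)) ?_ hq hq' hqq' (s.append (wl.append s'.reverse)) ?_ ?_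
  · intro h
    have hB : (R.path (spine i)).walk.getVert t ∈ bundle R i j := Or.inl hmid.mem
    rcases hrest _ h with h | ⟨j', hj', h⟩
    · rcases R.adj_of_mem (by simp) (hmem t) h with h | h <;> cases h
    · exact hj' (bundle_disjoint R h hB).2
  · intro z hz hz'
    rcases hrest z hz' with h | ⟨j', hj', h⟩
    · exact (hw z hz).2.1 h
    · exact (hw z hz).2.2 j' hj' h
  · exact fun k _ _ h => (hw _ h).1 (hmem k)

/-- The alternative depends on whether the spine ends on the gadget. If so, the position `τ` is `0`
or the length and nothing lies beyond it; otherwise `not_straight` applies at a common end unless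
the spine bends there. -/
theorem exists_bend_or_extreme {i : Fin 3}
    (hH : ∀ j, ∀ z ∈ bundle R i j, ¬ (R.path hub).IsEnd z) (j : Fin m) :
    (∃ t < (R.path (spine i)).walk.length - 1,
      ((R.path (spine i)).walk.getVert t).1 ≠ ((R.path (spine i)).walk.getVert (t + 2)).1 ∧
      ((R.path (spine i)).walk.getVert t).2 ≠ ((R.path (spine i)).walk.getVert (t + 2)).2 ∧
      (R.path (spine i)).walk.getVert (t + 1) ∈ bundle R i j) ∨
    ∃ τ ≤ (R.path (spine i)).walk.length, (R.path (spine i)).walk.getVert τ ∈ bundle R i j ∧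
      ∀ j₁ j₂ a b, j₁ ≠ j → j₂ ≠ j → a < τ → τ < b → b ≤ (R.path (spine i)).walk.length →
        (R.path (spine i)).walk.getVert a ∈ bundle R i j₁ →
        (R.path (spine i)).walk.getVert b ∈ bundle R i j₂ → False := by
  by_cases hU : ∀ z ∈ bundle R i j, ¬ (R.path (spine i)).IsEnd z
  · obtain ⟨β, p, hp, harm, hmid⟩ := exists_common_end R (hH j) hU
    obtain ⟨t, rfl, ht⟩ := Walk.mem_support_iff_exists_getVert.mp hp
    have hB : (R.path (spine i)).walk.getVert t ∈ bundle R i j := Or.inl hmid.mem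
    have ht0 : t ≠ 0 := by
      rintro rfl
      exact hU _ hB (Or.inl (by simp))
    have htl : t ≠ (R.path (spine i)).walk.length := by
      rintro rfl
      exact hU _ hB (Or.inr (by simp))
    by_cases hv : ((R.path (spine i)).walk.getVert (t - 1)).1 =
        ((R.path (spine i)).walk.getVert (t + 1)).1 ∨
      ((R.path (spine i)).walk.getVert (t - 1)).2 =
        ((R.path (spine i)).walk.getVert (t + 1)).2
    · exact Or.inr ⟨t, ht, hB, fun j₁ j₂ a b h1 h2 h3 h4 h5 h6 h7 =>
        not_straight R (hH j) hU harm hmid hv h1 h2 h3 h4 h5 h6 h7⟩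
    · push Not at hv
      -- `numBends` indexes a bend by the vertex before it.
      obtain ⟨s, rfl⟩ : ∃ s, t = s + 1 := ⟨t - 1, by omega⟩
      exact Or.inl ⟨s, by omega, hv.1, hv.2, hB⟩
  · push Not at hU
    obtain ⟨z, hz, rfl | rfl⟩ := hU
    · exact Or.inr ⟨0, by omega, by simpa using hz, fun _ _ a _ _ _ h => by omega⟩
    · exact Or.inr ⟨_, le_rfl, by simpa using hz, fun _ _ _ b _ _ _ h h' => by omega⟩

theorem card_le_two_of_forall_not_between {α : Type*} (s : Finset α) (τ : α → ℕ)
    (hτ : Set.InjOn τ s)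
    (h : ∀ x ∈ s, ∀ y ∈ s, ∀ z ∈ s, τ x < τ y → τ y < τ z → False) : s.card ≤ 2 := by
  by_contra! hc
  obtain ⟨a, b, c, ha, hb, hc, hab, hac, hbc⟩ := Finset.two_lt_card_iff.mp hc
  have h1 : τ a ≠ τ b := fun e => hab (hτ ha hb e)
  have h2 : τ a ≠ τ c := fun e => hac (hτ ha hc e)
  have h3 : τ b ≠ τ c := fun e => hbc (hτ hb hc e)
  rcases lt_or_gt_of_ne h1 with h1 | h1 <;> rcases lt_or_gt_of_ne h2 with h2 | h2 <;>
    rcases lt_or_gt_of_ne h3 with h3 | h3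
  · exact h a ha b hb c hc h1 h3
  · exact h a ha c hc b hb h2 h3
  · omega
  · exact h c hc a ha b hb h2 h1
  · exact h b hb a ha c hc h1 h2
  · omega
  · exact h b hb c hc a ha h3 h2
  · exact h c hc b hb a ha h3 h1

/-- Gadgets with a bend inject into the bends because gadgets are disjoint; of three gadgets without
one, the middle position along the spine would contradict extremality. -/
theorem le_numBends_spine {i : Fin 3}
    (hH : ∀ j, ∀ z ∈ bundle R i j, ¬ (R.path hub).IsEnd z) :
    m ≤ (R.path (spine i)).numBends + 2 := by
  classical
  set w := (R.path (spine i)).walk with hw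
  let Bend : Fin m → Prop := fun j => ∃ t < w.length - 1,
    (w.getVert t).1 ≠ (w.getVert (t + 2)).1 ∧ (w.getVert t).2 ≠ (w.getVert (t + 2)).2 ∧
      w.getVert (t + 1) ∈ bundle R i j
  have h1 : (Finset.univ.filter Bend).card ≤ (R.path (spine i)).numBends := by
    have hB : ∀ j ∈ Finset.univ.filter Bend, Bend j := fun j hj => (Finset.mem_filter.mp hj).2
    choose! t ht1 ht2 ht3 ht4 using hB
    refine Finset.card_le_card_of_injOn t (fun j hj => ?_) fun j hj j' hj' h => ?_
    · rw [Finset.mem_coe, Finset.mem_filter, Finset.mem_range]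
      exact ⟨ht1 j hj, ht2 j hj, ht3 j hj⟩
    · have e := ht4 j' hj'
      rw [← h] at e
      exact (bundle_disjoint R (ht4 j hj) e).2
  have h2 : (Finset.univ.filter fun j => ¬ Bend j).card ≤ 2 := by
    have hB : ∀ j ∈ Finset.univ.filter (fun j => ¬ Bend j), _ := fun j hj =>
      (exists_bend_or_extreme R hH j).resolve_left (Finset.mem_filter.mp hj).2
    choose! τ hτ1 hτ2 hτ3 using hB
    refine card_le_two_of_forall_not_between _ τ (fun j hj j' hj' h => ?_) ?_
    · have e := hτ2 j' hj'
      rw [← h] at e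
      exact (bundle_disjoint R (hτ2 j hj) e).2
    · intro x hx y hy z hz hxy hyz
      exact hτ3 y hy x z _ _ (by rintro rfl; omega) (by rintro rfl; omega) hxy hyz (hτ1 z hz)
        (hτ2 x hx) (hτ2 z hz)
  have h3 := Finset.card_filter_add_card_filter_not (s := Finset.univ) Bend
  rw [Finset.card_univ, Fintype.card_fin] at h3
  omega

/-- Three disjoint copies cannot all contain one of the two ends of the hub. -/
theorem exists_hub_free :
    ∃ i, ∀ j, ∀ z ∈ bundle R i j, ¬ (R.path hub).IsEnd z := by
  by_contra! hc
  choose j z hz hend using hc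
  have hne : ∀ i i', i ≠ i' → z i ≠ z i' := fun i i' h e =>
    h (bundle_disjoint R (hz i) (e ▸ hz i')).1
  exact hne 0 1 (by decide)
    ((hend 0).eq_of_ne (hend 1) (hend 2) (hne 0 2 (by decide)) (hne 1 2 (by decide)))

theorem not_isBCPG_fanGraph (k : ℕ) : ¬ IsBCPG k (fanGraph.{u} (k + 3)) := by
  rintro ⟨R, hR⟩
  obtain ⟨i, hi⟩ := exists_hub_free R
  have := le_numBends_spine R hi
  have := hR (spine i)
  omega

end LowerBound

/-! ### Explicit grid paths: one-bend paths and staircases -/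

namespace GridPath

/-- The grid path that visits `f 0, f 1, …, f L`. -/
def ofFun (f : ℕ → ℤ × ℤ) (L : ℕ) (hL : 0 < L) (hadj : ∀ i < L, grid.Adj (f i) (f (i + 1)))
    (hinj : ∀ i j, i ≤ L → j ≤ L → f i = f j → i = j) : GridPath where
  src := f 0
  tgt := f L
  walk := walkOf f L hadj
  isPath := isPath_walkOf f L hadj hinj
  src_ne_tgt h := hL.ne (hinj _ _ (Nat.zero_le L) (le_refl L) h)

variable {f : ℕ → ℤ × ℤ} {L : ℕ} {hL : 0 < L} {hadj : ∀ i < L, grid.Adj (f i) (f (i + 1))}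
  {hinj : ∀ i j, i ≤ L → j ≤ L → f i = f j → i = j}

theorem mem_points_ofFun {z : ℤ × ℤ} :
    z ∈ (ofFun f L hL hadj hinj).points ↔ ∃ i ≤ L, f i = z := mem_support_walkOf

/-- The function `g` numbers the bends injectively by `1, …, n`. -/
theorem numBends_ofFun_le {n : ℕ} (g : ℕ → ℕ)
    (hg : ∀ i, i + 2 ≤ L → (f i).1 ≠ (f (i + 2)).1 → (f i).2 ≠ (f (i + 2)).2 →
      1 ≤ g i ∧ g i ≤ n)
    (hg' : ∀ i j, i + 2 ≤ L → j + 2 ≤ L → (f i).1 ≠ (f (i + 2)).1 → (f i).2 ≠ (f (i + 2)).2 →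
      (f j).1 ≠ (f (j + 2)).1 → (f j).2 ≠ (f (j + 2)).2 → g i = g j → i = j) :
    (ofFun f L hL hadj hinj).numBends ≤ n := by
  have key : ∀ i ∈ (Finset.range ((walkOf f L hadj).length - 1)).filter (fun i =>
      ((walkOf f L hadj).getVert i).1 ≠ ((walkOf f L hadj).getVert (i + 2)).1 ∧
      ((walkOf f L hadj).getVert i).2 ≠ ((walkOf f L hadj).getVert (i + 2)).2),
      i + 2 ≤ L ∧ (f i).1 ≠ (f (i + 2)).1 ∧ (f i).2 ≠ (f (i + 2)).2 := by
    intro i hi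
    rw [Finset.mem_filter, Finset.mem_range, length_walkOf] at hi
    have h2 : i + 2 ≤ L := by omega
    rw [getVert_walkOf f L hadj (by omega), getVert_walkOf f L hadj h2] at hi
    exact ⟨h2, hi.2⟩
  have := Finset.card_le_card_of_injOn (t := Finset.Icc 1 n) g
    (fun i hi => Finset.mem_coe.mpr (Finset.mem_Icc.mpr
      (hg i (key i hi).1 (key i hi).2.1 (key i hi).2.2)))
    (fun i hi j hj => hg' i j (key i hi).1 (key j hj).1 (key i hi).2.1 (key i hi).2.2
      (key j hj).2.1 (key j hj).2.2)
  exact this.trans_eq (by simp)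

end GridPath

/-- The data of a path with at most one bend: it runs horizontally from `(x₀, y₀)` to `(x₁, y₀)`
and then vertically to `(x₁, y₁)`. -/
structure Ell where
  x₀ : ℤ
  y₀ : ℤ
  x₁ : ℤ
  y₁ : ℤ

namespace Ell

/-- The grid-points of the path. -/
def On (e : Ell) (z : ℤ × ℤ) : Prop :=
  (z.2 = e.y₀ ∧ (e.x₀ ≤ z.1 ∧ z.1 ≤ e.x₁ ∨ e.x₁ ≤ z.1 ∧ z.1 ≤ e.x₀)) ∨
    (z.1 = e.x₁ ∧ (e.y₀ ≤ z.2 ∧ z.2 ≤ e.y₁ ∨ e.y₁ ≤ z.2 ∧ z.2 ≤ e.y₀))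

/-- The endpoints of the path. -/
def End (e : Ell) (z : ℤ × ℤ) : Prop :=
  (z.1 = e.x₀ ∧ z.2 = e.y₀) ∨ (z.1 = e.x₁ ∧ z.2 = e.y₁)

/-- The grid-point number `i` of the path. -/
def pos (e : Ell) (i : ℕ) : ℤ × ℤ :=
  (if i ≤ (e.x₁ - e.x₀).natAbs then (if e.x₀ ≤ e.x₁ then e.x₀ + i else e.x₀ - i) else e.x₁,
    if i ≤ (e.x₁ - e.x₀).natAbs then e.y₀ else
      if e.y₀ ≤ e.y₁ then e.y₀ + (i - (e.x₁ - e.x₀).natAbs) else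
        e.y₀ - (i - (e.x₁ - e.x₀).natAbs))

/-- The length of the path. -/
def length (e : Ell) : ℕ := (e.x₁ - e.x₀).natAbs + (e.y₁ - e.y₀).natAbs

/-- The path as a grid path. -/
def path (e : Ell) (h : ¬ (e.x₀ = e.x₁ ∧ e.y₀ = e.y₁)) : GridPath :=
  .ofFun e.pos e.length (by unfold length; omega)
    (by
      intro i hi
      rw [grid_adj_iff]
      unfold pos
      unfold length at hi
      dsimp only
      split_ifs <;> omega)
    (by
      intro i j hi hj hij
      simp only [length] at hi hj
      simp only [pos, Prod.ext_iff] at hij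
      split_ifs at hij <;> omega)

variable {e : Ell} {h : ¬ (e.x₀ = e.x₁ ∧ e.y₀ = e.y₁)}

theorem mem_points_path {z : ℤ × ℤ} : z ∈ (e.path h).points ↔ e.On z := by
  rw [path, GridPath.mem_points_ofFun]
  constructor
  · rintro ⟨i, hi, rfl⟩
    unfold length at hi
    unfold On pos
    dsimp only
    split_ifs <;> omega
  · intro hz
    unfold On at hz
    by_cases hx : z.2 = e.y₀ ∧ (e.x₀ ≤ z.1 ∧ z.1 ≤ e.x₁ ∨ e.x₁ ≤ z.1 ∧ z.1 ≤ e.x₀)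
    · refine ⟨(z.1 - e.x₀).natAbs, by unfold length; omega, ?_⟩
      simp only [pos, Prod.ext_iff]
      split_ifs <;> omega
    · refine ⟨(e.x₁ - e.x₀).natAbs + (z.2 - e.y₀).natAbs, by unfold length; omega, ?_⟩
      simp only [pos, Prod.ext_iff]
      split_ifs <;> omega

theorem isEnd_path {z : ℤ × ℤ} (hz : e.End z) : (e.path h).IsEnd z := by
  rcases hz with hz | hz
  · refine Or.inl ?_
    change z = e.pos 0
    simp [pos, Prod.ext_iff, hz]
  · refine Or.inr ?_
    change z = e.pos e.length
    simp only [pos, length, Prod.ext_iff]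
    split_ifs <;> omega

theorem numBends_path_le : (e.path h).numBends ≤ 1 := by
  refine GridPath.numBends_ofFun_le (fun _ => 1) (fun _ _ _ _ => ⟨le_rfl, le_rfl⟩) ?_
  intro i j hi hj h1 h2 h3 h4 _
  have key : ∀ k, (e.pos k).1 ≠ (e.pos (k + 2)).1 → (e.pos k).2 ≠ (e.pos (k + 2)).2 →
      k + 1 = (e.x₁ - e.x₀).natAbs := by
    intro k h1 h2
    unfold pos at h1 h2
    dsimp only at h1 h2
    split_ifs at h1 h2 <;> omega
  have := key i h1 h2
  have := key j h3 h4
  omega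

end Ell

/-- An infinite descending staircase, all of whose steps have length `10`. -/
def stair (k : ℕ) : ℤ × ℤ :=
  (if k / 10 % 2 = 0 then 10 * (k / 20 : ℕ) + (k % 10 : ℕ) else 10 * (k / 20 : ℕ) + 10,
    if k / 10 % 2 = 0 then -10 * (k / 20 : ℕ) else -10 * (k / 20 : ℕ) - (k % 10 : ℕ))

/-- Each step goes right or down, so this difference recovers the index. -/
theorem stair_sub (k : ℕ) : (stair k).1 - (stair k).2 = k := by
  unfold stair
  dsimp only
  split_ifs <;> omega

theorem stair_injective : Function.Injective stair := fun i j h => by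
  have hi := stair_sub i
  have hj := stair_sub j
  rw [h] at hi
  omega

theorem stair_adj (k : ℕ) : grid.Adj (stair k) (stair (k + 1)) := by
  rw [grid_adj_iff]
  unfold stair
  dsimp only
  split_ifs <;> omega

/-- A finite part of the staircase: `n` steps, the first of them the step number `s`. -/
def stairPath (s n : ℕ) (hn : 0 < n) : GridPath :=
  .ofFun (fun k => stair (10 * s + k)) (10 * n) (by omega) (fun k _ => stair_adj (10 * s + k))
    fun i j _ _ h => by have := stair_injective h; omega

theorem mem_points_stairPath {s n : ℕ} {hn : 0 < n} {z : ℤ × ℤ} :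
    z ∈ (stairPath s n hn).points ↔ ∃ k, 10 * s ≤ k ∧ k ≤ 10 * (s + n) ∧ stair k = z := by
  rw [stairPath, GridPath.mem_points_ofFun]
  constructor
  · rintro ⟨k, hk, h⟩
    exact ⟨10 * s + k, by omega, by omega, h⟩
  · rintro ⟨k, hk, hk', h⟩
    exact ⟨k - 10 * s, by omega, by rwa [Nat.add_sub_cancel' hk]⟩

/-- Bends occur only at inner multiples of `10`, of which there are `n - 1`. -/
theorem numBends_stairPath_le {s n : ℕ} {hn : 0 < n} :
    (stairPath s n hn).numBends ≤ n - 1 := by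
  have key : ∀ k, (stair (10 * s + k)).1 ≠ (stair (10 * s + (k + 2))).1 →
      (stair (10 * s + k)).2 ≠ (stair (10 * s + (k + 2))).2 → (k + 1) % 10 = 0 := by
    intro k h1 h2
    unfold stair at h1 h2
    dsimp only at h1 h2
    split_ifs at h1 h2 <;> omega
  refine GridPath.numBends_ofFun_le (fun k => (k + 1) / 10) ?_ ?_
  · intro i hi h1 h2
    have := key i h1 h2
    omega
  · intro i j hi hj h1 h2 h3 h4 h
    have := key i h1 h2
    have := key j h3 h4
    omega

/-- A representation from paths such that any two of them have at most one common point. -/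
def Representation.mk' {V : Type u} {G : SimpleGraph V} (path : V → GridPath)
    (hadj : ∀ v w, G.Adj v w → ∃ z, (∀ z', z' ∈ (path v).points → z' ∈ (path w).points → z' = z) ∧
      z ∈ (path v).points ∧ z ∈ (path w).points ∧ ((path v).IsEnd z ∨ (path w).IsEnd z))
    (hnadj : ∀ v w, v ≠ w → ¬ G.Adj v w → ∀ z, z ∈ (path v).points → z ∉ (path w).points) :
    Representation G where
  path := path
  disjoint v w h := by
    by_cases hG : G.Adj v w
    · obtain ⟨z, hz, -, -, hend⟩ := hadj v w hG
      constructor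
      · rw [Set.disjoint_left]
        rintro x ⟨h1, h2, h3⟩ ⟨h4, h5, h6⟩
        obtain rfl := hz x h1 h4
        rcases hend with (h | h) | h | h <;> contradiction
      -- A common grid-edge would supply two common grid-points.
      · rw [Set.disjoint_left]
        intro e he he'
        induction e with
        | _ a b =>
          have h1 := hz a (Walk.fst_mem_support_of_mem_edges _ he)
            (Walk.fst_mem_support_of_mem_edges _ he')
          have h2 := hz b (Walk.snd_mem_support_of_mem_edges _ he)
            (Walk.snd_mem_support_of_mem_edges _ he')
          exact (Walk.adj_of_mem_edges _ he).ne (h1.trans h2.symm)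
    · constructor
      · rw [Set.disjoint_left]
        exact fun x h1 h2 => hnadj v w h hG x h1.1 h2.1
      · rw [Set.disjoint_left]
        intro e he he'
        induction e with
        | _ a b =>
          exact hnadj v w h hG a (Walk.fst_mem_support_of_mem_edges _ he)
            (Walk.fst_mem_support_of_mem_edges _ he')
  adj_iff v w h := by
    constructor
    · intro hG
      obtain ⟨z, -, h1, h2, -⟩ := hadj v w hG
      exact ⟨z, h1, h2⟩
    · rintro ⟨z, h1, h2⟩
      by_contra hG
      exact hnadj v w h hG z h1 h2

theorem stair_ten_mul (s : ℕ) :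
    (stair (10 * s)).1 = 10 * ((s + 1) / 2 : ℕ) ∧ (stair (10 * s)).2 = -10 * (s / 2 : ℕ) := by
  unfold stair
  dsimp only
  split_ifs <;> omega

/-! ### Placement of the gadgets along the staircase -/

/-- The orientation of a gadget: `0` if it extends to the left, `±1` if it extends upwards,
where the sign distinguishes the two mirror images. -/
def orient {m : ℕ} (j : Fin m) : ℤ := if j.1 = 0 then -1 else if j.1 % 2 = 1 then 1 else 0

/-- The corner of the staircase at which a gadget is placed. -/
def slot {m : ℕ} (i : Fin 3) (j : Fin m) : ℕ := 2 * m * i + j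

/-- Consecutive spines are separated by more than `m` unused steps of the staircase. -/
theorem slot_lt {m : ℕ} {i i' : Fin 3} (h : i < i') (j j' : Fin m) :
    slot i j + m < slot i' j' := by
  have h1 : 2 * m * (i.1 + 1) ≤ 2 * m * i'.1 := Nat.mul_le_mul_left _ h
  have := j.2
  unfold slot
  rw [Nat.mul_add] at h1
  omega

theorem slot_lt_mul {m : ℕ} (i : Fin 3) (j : Fin m) : slot i j < 5 * m := by
  have h1 : 2 * m * i.1 ≤ 2 * m * 2 := Nat.mul_le_mul_left _ (by omega)
  have := j.2
  unfold slot
  omega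

/-- Slot and `j` have the same parity. At an odd corner the staircase turns from right to down,
which leaves the directions up and right free; at an even one it turns from down to right, which
leaves left and down. The first corner of a spine is even but nothing arrives there, so up is free
as well. -/
theorem orient_cases {m : ℕ} (i : Fin 3) (j : Fin m) :
    (orient j = -1 ∧ slot i j % 2 = 0 ∧ slot i j = 2 * m * i) ∨
      (orient j = 1 ∧ slot i j % 2 = 1) ∨ (orient j = 0 ∧ slot i j % 2 = 0) := by
  have h : 2 * m * i.1 = 2 * (m * i.1) := mul_assoc _ _ _
  unfold orient slot
  split_ifs <;> omega

/-- The paths of the arms of a gadget with orientation `σ` that is placed at `p`. -/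
def armBox (b : Bool) (p : ℤ × ℤ) (σ : ℤ) : Ell :=
  match b with
  | false => if σ = 0 then ⟨-20, p.2 - 2, p.1, p.2⟩ else ⟨p.1, p.2, p.1 + 2 * σ, 20⟩
  | true => if σ = 0 then ⟨-20, p.2 + 1, p.1, p.2 + 1⟩ else ⟨p.1 - σ, p.2, p.1 - σ, 20⟩

/-- The path of the middle vertex of a gadget with orientation `σ` that is placed at `p`. -/
def midBox (p : ℤ × ℤ) (σ : ℤ) : Ell :=
  if σ = 0 then ⟨p.1, p.2, p.1 - 3, p.2 + 1⟩ else ⟨p.1 - σ, p.2 + 3, p.1, p.2⟩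

/-- The paths of the links of a gadget with orientation `σ` that is placed at `p`. -/
def linkBox (b : Bool) (p : ℤ × ℤ) (σ : ℤ) : Ell :=
  match b with
  | false => if σ = 0 then ⟨p.1, p.2 - 1, p.1 - 2, p.2⟩ else ⟨p.1, p.2 + 2, p.1 + σ, p.2⟩
  | true => if σ = 0 then ⟨p.1 - 1, p.2, p.1 - 1, p.2 + 1⟩ else ⟨p.1, p.2 + 1, p.1 - σ, p.2 + 1⟩

/-- The path of the hub. -/
def hubBox (m : ℕ) : Ell := ⟨30 * m + 30, 20, -20, -(30 * m + 30)⟩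

theorem armBox_ne (b : Bool) {s : ℕ} {σ : ℤ} : ¬ ((armBox b (stair (10 * s)) σ).x₀ =
    (armBox b (stair (10 * s)) σ).x₁ ∧ (armBox b (stair (10 * s)) σ).y₀ =
      (armBox b (stair (10 * s)) σ).y₁) := by
  have := stair_ten_mul s
  unfold armBox
  rcases b <;> dsimp only <;> split_ifs <;> dsimp only <;> omega

theorem midBox_ne {p : ℤ × ℤ} {σ : ℤ} :
    ¬ ((midBox p σ).x₀ = (midBox p σ).x₁ ∧ (midBox p σ).y₀ = (midBox p σ).y₁) := by
  unfold midBox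
  split_ifs <;> dsimp only <;> omega

theorem linkBox_ne {b : Bool} {p : ℤ × ℤ} {σ : ℤ} :
    ¬ ((linkBox b p σ).x₀ = (linkBox b p σ).x₁ ∧ (linkBox b p σ).y₀ = (linkBox b p σ).y₁) := by
  unfold linkBox
  rcases b <;> dsimp only <;> split_ifs <;> dsimp only <;> omega

theorem hubBox_ne {m : ℕ} :
    ¬ ((hubBox m).x₀ = (hubBox m).x₁ ∧ (hubBox m).y₀ = (hubBox m).y₁) := by
  unfold hubBox
  dsimp only
  omega

/-- A region that contains a gadget. -/
def region (p : ℤ × ℤ) (σ : ℤ) (z : ℤ × ℤ) : Prop :=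
  (σ = 0 ∧ -20 ≤ z.1 ∧ z.1 ≤ p.1 ∧ p.2 - 2 ≤ z.2 ∧ z.2 ≤ p.2 + 1) ∨
    (σ ≠ 0 ∧ p.1 - 2 ≤ z.1 ∧ z.1 ≤ p.1 + 2 ∧ p.2 ≤ z.2 ∧ z.2 ≤ 20)

theorem exists_meet {e e' : Ell} (a b : ℤ)
    (h : ∀ c d, e.On (c, d) → e'.On (c, d) → c = a ∧ d = b) (h₁ : e.On (a, b))
    (h₂ : e'.On (a, b)) (h₃ : e.End (a, b) ∨ e'.End (a, b)) :
    ∃ x, (∀ z, e.On z → e'.On z → z = x) ∧ e.On x ∧ e'.On x ∧ (e.End x ∨ e'.End x) :=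
  ⟨(a, b), fun z hz hz' => Prod.ext_iff.mpr (h z.1 z.2 hz hz'),
    h₁, h₂, h₃⟩

/-! ### Contacts within a gadget and with the hub -/

section Local

variable {p z : ℤ × ℤ} {σ : ℤ} (hσ : σ = -1 ∨ σ = 1 ∨ σ = 0) (hp : 0 ≤ p.1 ∧ p.2 ≤ 0)

include hσ

theorem not_linkBox_linkBox (h : (linkBox false p σ).On z) (h' : (linkBox true p σ).On z) :
    False := by
  rcases hσ with rfl | rfl | rfl <;> simp [linkBox, Ell.On] at h h' <;> omega

theorem linkBox_meets_midBox (b : Bool) : ∃ x,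
    (∀ z, (linkBox b p σ).On z → (midBox p σ).On z → z = x) ∧ (linkBox b p σ).On x ∧
      (midBox p σ).On x ∧ ((linkBox b p σ).End x ∨ (midBox p σ).End x) := by
  rcases hσ with rfl | rfl | rfl <;> rcases b
  · refine exists_meet p.1 (p.2 + 2) (fun c d h h' => ?_) ?_ ?_ ?_ <;>
      simp [linkBox, midBox, Ell.On, Ell.End] at * <;> omega
  · refine exists_meet p.1 (p.2 + 1) (fun c d h h' => ?_) ?_ ?_ ?_ <;>
      simp [linkBox, midBox, Ell.On, Ell.End] at * <;> omega
  · refine exists_meet p.1 (p.2 + 2) (fun c d h h' => ?_) ?_ ?_ ?_ <;>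
      simp [linkBox, midBox, Ell.On, Ell.End] at * <;> omega
  · refine exists_meet p.1 (p.2 + 1) (fun c d h h' => ?_) ?_ ?_ ?_ <;>
      simp [linkBox, midBox, Ell.On, Ell.End] at * <;> omega
  · refine exists_meet (p.1 - 2) p.2 (fun c d h h' => ?_) ?_ ?_ ?_ <;>
      simp [linkBox, midBox, Ell.On, Ell.End] at * <;> omega
  · refine exists_meet (p.1 - 1) p.2 (fun c d h h' => ?_) ?_ ?_ ?_ <;>
      simp [linkBox, midBox, Ell.On, Ell.End] at * <;> omega

include hp

theorem region_of_armBox {b : Bool} (h : (armBox b p σ).On z) : region p σ z := by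
  rcases hσ with rfl | rfl | rfl <;> rcases b <;> simp [armBox, Ell.On, region] at h ⊢ <;> omega

theorem region_of_midBox (h : (midBox p σ).On z) : region p σ z := by
  rcases hσ with rfl | rfl | rfl <;> simp [midBox, Ell.On, region] at h ⊢ <;> omega

theorem region_of_linkBox {b : Bool} (h : (linkBox b p σ).On z) : region p σ z := by
  rcases hσ with rfl | rfl | rfl <;> rcases b <;> simp [linkBox, Ell.On, region] at h ⊢ <;> omega

theorem not_armBox_armBox (h : (armBox false p σ).On z) (h' : (armBox true p σ).On z) : False := by
  rcases hσ with rfl | rfl | rfl <;> simp [armBox, Ell.On] at h h' <;> omega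

theorem not_linkBox_armBox {b : Bool} (h : (linkBox b p σ).On z) (h' : (armBox (!b) p σ).On z) :
    False := by
  rcases hσ with rfl | rfl | rfl <;> rcases b <;> simp [armBox, linkBox, Ell.On] at h h' <;> omega

theorem armBox_meets_midBox (b : Bool) : ∃ x,
    (∀ z, (armBox b p σ).On z → (midBox p σ).On z → z = x) ∧ (armBox b p σ).On x ∧
      (midBox p σ).On x ∧ ((armBox b p σ).End x ∨ (midBox p σ).End x) := by
  rcases hσ with rfl | rfl | rfl <;> rcases b
  · refine exists_meet p.1 p.2 (fun c d h h' => ?_) ?_ ?_ ?_ <;>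
      simp [armBox, midBox, Ell.On, Ell.End] at * <;> omega
  · refine exists_meet (p.1 + 1) (p.2 + 3) (fun c d h h' => ?_) ?_ ?_ ?_ <;>
      simp [armBox, midBox, Ell.On, Ell.End] at * <;> omega
  · refine exists_meet p.1 p.2 (fun c d h h' => ?_) ?_ ?_ ?_ <;>
      simp [armBox, midBox, Ell.On, Ell.End] at * <;> omega
  · refine exists_meet (p.1 - 1) (p.2 + 3) (fun c d h h' => ?_) ?_ ?_ ?_ <;>
      simp [armBox, midBox, Ell.On, Ell.End] at * <;> omega
  · refine exists_meet p.1 p.2 (fun c d h h' => ?_) ?_ ?_ ?_ <;>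
      simp [armBox, midBox, Ell.On, Ell.End] at * <;> omega
  · refine exists_meet (p.1 - 3) (p.2 + 1) (fun c d h h' => ?_) ?_ ?_ ?_ <;>
      simp [armBox, midBox, Ell.On, Ell.End] at * <;> omega

theorem linkBox_meets_armBox (b : Bool) : ∃ x,
    (∀ z, (linkBox b p σ).On z → (armBox b p σ).On z → z = x) ∧ (linkBox b p σ).On x ∧
      (armBox b p σ).On x ∧ ((linkBox b p σ).End x ∨ (armBox b p σ).End x) := by
  rcases hσ with rfl | rfl | rfl <;> rcases b
  · refine exists_meet (p.1 - 1) p.2 (fun c d h h' => ?_) ?_ ?_ ?_ <;>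
      simp [linkBox, armBox, Ell.On, Ell.End] at * <;> omega
  · refine exists_meet (p.1 + 1) (p.2 + 1) (fun c d h h' => ?_) ?_ ?_ ?_ <;>
      simp [linkBox, armBox, Ell.On, Ell.End] at * <;> omega
  · refine exists_meet (p.1 + 1) p.2 (fun c d h h' => ?_) ?_ ?_ ?_ <;>
      simp [linkBox, armBox, Ell.On, Ell.End] at * <;> omega
  · refine exists_meet (p.1 - 1) (p.2 + 1) (fun c d h h' => ?_) ?_ ?_ ?_ <;>
      simp [linkBox, armBox, Ell.On, Ell.End] at * <;> omega
  · refine exists_meet p.1 (p.2 - 1) (fun c d h h' => ?_) ?_ ?_ ?_ <;>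
      simp [linkBox, armBox, Ell.On, Ell.End] at * <;> omega
  · refine exists_meet (p.1 - 1) (p.2 + 1) (fun c d h h' => ?_) ?_ ?_ ?_ <;>
      simp [linkBox, armBox, Ell.On, Ell.End] at * <;> omega

theorem armBox_meets_hubBox (b : Bool) {m : ℕ} (hm : p.1 ≤ 30 * m ∧ -(30 * m : ℤ) ≤ p.2) : ∃ x,
    (∀ z, (armBox b p σ).On z → (hubBox m).On z → z = x) ∧ (armBox b p σ).On x ∧
      (hubBox m).On x ∧ ((armBox b p σ).End x ∨ (hubBox m).End x) := by
  rcases hσ with rfl | rfl | rfl <;> rcases b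
  · refine exists_meet (p.1 - 2) 20 (fun c d h h' => ?_) ?_ ?_ ?_ <;>
      simp [hubBox, armBox, Ell.On, Ell.End] at * <;> omega
  · refine exists_meet (p.1 + 1) 20 (fun c d h h' => ?_) ?_ ?_ ?_ <;>
      simp [hubBox, armBox, Ell.On, Ell.End] at * <;> omega
  · refine exists_meet (p.1 + 2) 20 (fun c d h h' => ?_) ?_ ?_ ?_ <;>
      simp [hubBox, armBox, Ell.On, Ell.End] at * <;> omega
  · refine exists_meet (p.1 - 1) 20 (fun c d h h' => ?_) ?_ ?_ ?_ <;>
      simp [hubBox, armBox, Ell.On, Ell.End] at * <;> omega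
  · refine exists_meet (-20) (p.2 - 2) (fun c d h h' => ?_) ?_ ?_ ?_ <;>
      simp [hubBox, armBox, Ell.On, Ell.End] at * <;> omega
  · refine exists_meet (-20) (p.2 + 1) (fun c d h h' => ?_) ?_ ?_ ?_ <;>
      simp [hubBox, armBox, Ell.On, Ell.End] at * <;> omega

theorem not_midBox_hubBox {m : ℕ} (h : (midBox p σ).On z) (h' : (hubBox m).On z) : False := by
  rcases hσ with rfl | rfl | rfl <;> simp [midBox, hubBox, Ell.On] at h h' <;> omega

theorem not_linkBox_hubBox {b : Bool} {m : ℕ} (h : (linkBox b p σ).On z)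
    (h' : (hubBox m).On z) : False := by
  rcases hσ with rfl | rfl | rfl <;> rcases b <;> simp [linkBox, hubBox, Ell.On] at h h' <;> omega

end Local

/-! ### Separation of gadgets from each other and from the staircase -/

theorem not_hubBox_stair {m k : ℕ} (h : (hubBox m).On (stair k)) : False := by
  have : 0 ≤ (stair k).1 ∧ (stair k).2 ≤ 0 := by
    unfold stair
    dsimp only
    split_ifs <;> omega
  simp only [hubBox, Ell.On] at h
  omega

/-- The later gadget lies to the right of the earlier one if it extends upwards, and below it if it
extends to the left. An even corner is in the same column as the odd corner before it, so the upward
extension from an even corner needs a gap. -/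
theorem not_region_region {s s' : ℕ} {σ σ' : ℤ} {z : ℤ × ℤ} (hs : s < s')
    (hσ : (σ = -1 ∧ s % 2 = 0) ∨ (σ = 1 ∧ s % 2 = 1) ∨ (σ = 0 ∧ s % 2 = 0))
    (hσ' : (σ' = -1 ∧ s' % 2 = 0 ∧ s + 3 < s') ∨ (σ' = 1 ∧ s' % 2 = 1) ∨ (σ' = 0 ∧ s' % 2 = 0))
    (h : region (stair (10 * s)) σ z) (h' : region (stair (10 * s')) σ' z) : False := by
  have h1 := stair_ten_mul s
  have h2 := stair_ten_mul s'
  unfold region at h h'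
  rcases hσ with ⟨rfl, hσ⟩ | ⟨rfl, hσ⟩ | ⟨rfl, hσ⟩ <;>
    rcases hσ' with ⟨rfl, hσ'⟩ | ⟨rfl, hσ'⟩ | ⟨rfl, hσ'⟩ <;> simp at h h' <;> omega

theorem not_region_stair {s k : ℕ} {σ : ℤ} (hk : 10 * s + 20 < k ∨ k + 20 < 10 * s)
    (hσ : (σ = -1 ∧ s % 2 = 0) ∨ (σ = 1 ∧ s % 2 = 1) ∨ (σ = 0 ∧ s % 2 = 0))
    (h : region (stair (10 * s)) σ (stair k)) : False := by
  have h1 := stair_ten_mul s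
  unfold region at h
  generalize stair (10 * s) = p at h1 h
  unfold stair at h
  dsimp only at h
  rcases hσ with ⟨rfl, hσ⟩ | ⟨rfl, hσ⟩ | ⟨rfl, hσ⟩ <;> simp at h <;> split_ifs at h <;> omega

section Spine

variable {s k : ℕ} {σ : ℤ}
    (hσ : (σ = -1 ∧ s % 2 = 0 ∧ 10 * s ≤ k) ∨ (σ = 1 ∧ s % 2 = 1) ∨ (σ = 0 ∧ s % 2 = 0))

include hσ

/-- For `σ = -1` the gadget overlaps the vertical step of the infinite staircase that comes down to
its corner; the bound `10 * s ≤ k` discards this step, as the spine starts at the corner. -/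
theorem not_linkBox_stair {b : Bool} (h : (linkBox b (stair (10 * s)) σ).On (stair k)) :
    False := by
  have h1 := stair_ten_mul s
  generalize stair (10 * s) = p at h1 h
  unfold stair at h
  rcases hσ with ⟨rfl, hσ⟩ | ⟨rfl, hσ⟩ | ⟨rfl, hσ⟩ <;> rcases b <;>
    simp [linkBox, Ell.On] at h <;> split_ifs at h <;> omega

theorem eq_of_midBox_stair (h : (midBox (stair (10 * s)) σ).On (stair k)) : k = 10 * s := by
  have h1 := stair_ten_mul s
  generalize stair (10 * s) = p at h1 h
  unfold stair at h
  rcases hσ with ⟨rfl, hσ⟩ | ⟨rfl, hσ⟩ | ⟨rfl, hσ⟩ <;>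
    simp [midBox, Ell.On] at h <;> split_ifs at h <;> omega

theorem eq_of_armBox_stair {b : Bool} (h : (armBox b (stair (10 * s)) σ).On (stair k)) :
    k = if b then (if σ = -1 then 10 * s + 1 else 10 * s - 1) else 10 * s := by
  have h1 := stair_ten_mul s
  generalize stair (10 * s) = p at h1 h
  unfold stair at h
  rcases hσ with ⟨rfl, hσ⟩ | ⟨rfl, hσ⟩ | ⟨rfl, hσ⟩ <;> rcases b <;>
    simp [armBox, Ell.On] at h ⊢ <;> split_ifs at h <;> omega

end Spine

theorem midBox_stair (s : ℕ) (σ : ℤ) : (midBox (stair (10 * s)) σ).End (stair (10 * s)) ∧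
    (midBox (stair (10 * s)) σ).On (stair (10 * s)) := by
  unfold midBox
  split_ifs <;> simp [Ell.On, Ell.End]

/-- The second arm ends on the spine one unit beside the corner: after it at the start of a spine,
before it elsewhere. The condition `0 < s` keeps `10 * s - 1` from being truncated. -/
theorem armBox_stair {b : Bool} {s : ℕ} {σ : ℤ}
    (hσ : (σ = -1 ∧ s % 2 = 0) ∨ (σ = 1 ∧ s % 2 = 1) ∨ (σ = 0 ∧ s % 2 = 0 ∧ 0 < s)) {k : ℕ}
    (hk : k = if b then (if σ = -1 then 10 * s + 1 else 10 * s - 1) else 10 * s) :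
    (armBox b (stair (10 * s)) σ).End (stair k) ∧ (armBox b (stair (10 * s)) σ).On (stair k) := by
  have h1 := stair_ten_mul s
  rcases b
  · simp only [Bool.false_eq_true, if_false] at hk
    subst hk
    rcases hσ with ⟨rfl, hσ⟩ | ⟨rfl, hσ⟩ | ⟨rfl, hσ⟩ <;> simp [armBox, Ell.On, Ell.End]
  · have h2 : (stair k).1 = (stair (10 * s)).1 - σ ∧
        (stair k).2 = (stair (10 * s)).2 + (if σ = 0 then 1 else 0) := by
      rw [h1.1, h1.2]
      unfold stair
      rcases hσ with ⟨rfl, hσ⟩ | ⟨rfl, hσ⟩ | ⟨rfl, hσ⟩ <;> simp at hk ⊢ <;> split_ifs <;> omega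
    rcases hσ with ⟨rfl, hσ⟩ | ⟨rfl, hσ⟩ | ⟨rfl, hσ⟩ <;>
      simp [armBox, Ell.On, Ell.End] at h2 ⊢ <;> omega

/-! ### The representation of the separating graph -/

variable {m : ℕ}

/-- The grid paths that represent `fanGraph m`. -/
def fanPath (hm : 3 ≤ m) : FanVertex.{u} m → GridPath
  | hub => (hubBox m).path hubBox_ne
  | spine i => stairPath (2 * m * i) (m - 1) (by omega)
  | arm b i j => (armBox b (stair (10 * slot i j)) (orient j)).path (armBox_ne b)
  | mid i j => (midBox (stair (10 * slot i j)) (orient j)).path midBox_ne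
  | link b i j => (linkBox b (stair (10 * slot i j)) (orient j)).path linkBox_ne

theorem orient_eq (j : Fin m) : orient j = -1 ∨ orient j = 1 ∨ orient j = 0 := by
  unfold orient
  split_ifs <;> simp

theorem stair_slot_sign (i : Fin 3) (j : Fin m) :
    0 ≤ (stair (10 * slot i j)).1 ∧ (stair (10 * slot i j)).2 ≤ 0 := by
  have := stair_ten_mul (slot i j)
  omega

theorem not_region_region_of_lt (hm : 3 ≤ m) {i i' : Fin 3} {j j' : Fin m}
    (h : i < i' ∨ (i = i' ∧ j < j')) {z : ℤ × ℤ} (hz : region (stair (10 * slot i j)) (orient j) z)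
    (hz' : region (stair (10 * slot i' j')) (orient j') z) : False := by
  have h1 := orient_cases i j
  have h2 := orient_cases i' j'
  -- Orientation `-1` belongs to `j' = 0`, so an earlier gadget lies in an earlier copy, more than
  -- `m ≥ 3` steps away.
  have h3 : slot i j < slot i' j' ∧ (orient j' = -1 → slot i j + 3 < slot i' j') := by
    rcases h with h | ⟨rfl, h⟩
    · have := slot_lt h j j'
      omega
    · have h' : j.1 < j'.1 := h
      unfold slot orient
      refine ⟨by omega, fun e => ?_⟩
      split_ifs at e
      omega
  exact not_region_region h3.1 (by omega) (by omega) hz hz'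

theorem slot_eq_of_region (hm : 3 ≤ m) {i i' : Fin 3} {j j' : Fin m} {z : ℤ × ℤ}
    (hz : region (stair (10 * slot i j)) (orient j) z)
    (hz' : region (stair (10 * slot i' j')) (orient j') z) : i = i' ∧ j = j' := by
  rcases lt_trichotomy i i' with h | h | h
  · exact (not_region_region_of_lt hm (Or.inl h) hz hz').elim
  · rcases lt_trichotomy j j' with h' | h' | h'
    · exact (not_region_region_of_lt hm (Or.inr ⟨h, h'⟩) hz hz').elim
    · exact ⟨h, h'⟩
    · exact (not_region_region_of_lt hm (Or.inr ⟨h.symm, h'⟩) hz' hz).elim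
  · exact (not_region_region_of_lt hm (Or.inl h) hz' hz).elim

theorem mem_hub (hm : 3 ≤ m) {z : ℤ × ℤ} :
    z ∈ (fanPath.{u} hm hub).points ↔ (hubBox m).On z :=
  Ell.mem_points_path (h := hubBox_ne)

theorem mem_arm (hm : 3 ≤ m) {b : Bool} {i : Fin 3} {j : Fin m} {z : ℤ × ℤ} :
    z ∈ (fanPath.{u} hm (arm b i j)).points ↔
      (armBox b (stair (10 * slot i j)) (orient j)).On z :=
  Ell.mem_points_path (h := armBox_ne b)

theorem mem_mid (hm : 3 ≤ m) {i : Fin 3} {j : Fin m} {z : ℤ × ℤ} :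
    z ∈ (fanPath.{u} hm (mid i j)).points ↔
      (midBox (stair (10 * slot i j)) (orient j)).On z :=
  Ell.mem_points_path (h := midBox_ne)

theorem mem_link (hm : 3 ≤ m) {b : Bool} {i : Fin 3} {j : Fin m} {z : ℤ × ℤ} :
    z ∈ (fanPath.{u} hm (link b i j)).points ↔
      (linkBox b (stair (10 * slot i j)) (orient j)).On z :=
  Ell.mem_points_path (h := linkBox_ne)

theorem mem_spine (hm : 3 ≤ m) {i : Fin 3} {z : ℤ × ℤ} :
    z ∈ (fanPath.{u} hm (spine i)).points ↔
      ∃ k, 10 * (2 * m * i) ≤ k ∧ k ≤ 10 * (2 * m * i + (m - 1)) ∧ stair k = z :=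
  mem_points_stairPath (hn := by omega)

theorem region_arm (hm : 3 ≤ m) {b : Bool} {i : Fin 3} {j : Fin m} {z : ℤ × ℤ}
    (h : z ∈ (fanPath.{u} hm (arm b i j)).points) :
    region (stair (10 * slot i j)) (orient j) z :=
  region_of_armBox (orient_eq j) (stair_slot_sign i j) ((mem_arm hm).mp h)

theorem region_mid (hm : 3 ≤ m) {i : Fin 3} {j : Fin m} {z : ℤ × ℤ}
    (h : z ∈ (fanPath.{u} hm (mid i j)).points) :
    region (stair (10 * slot i j)) (orient j) z :=
  region_of_midBox (orient_eq j) (stair_slot_sign i j) ((mem_mid hm).mp h)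

theorem region_link (hm : 3 ≤ m) {b : Bool} {i : Fin 3} {j : Fin m} {z : ℤ × ℤ}
    (h : z ∈ (fanPath.{u} hm (link b i j)).points) :
    region (stair (10 * slot i j)) (orient j) z :=
  region_of_linkBox (orient_eq j) (stair_slot_sign i j) ((mem_link hm).mp h)

theorem spine_eq_of_region (hm : 3 ≤ m) {i i' : Fin 3} {j : Fin m} {z : ℤ × ℤ}
    (h : z ∈ (fanPath.{u} hm (spine i')).points)
    (hz : region (stair (10 * slot i j)) (orient j) z) : i = i' := by
  obtain ⟨k, h1, h2, rfl⟩ := (mem_spine hm).mp h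
  have h3 := orient_cases i j
  by_contra hne
  refine not_region_stair ?_ (by omega) hz
  rcases lt_or_gt_of_ne hne with h | h
  · have := slot_lt h j ⟨0, by omega⟩
    unfold slot at this ⊢
    dsimp only at this
    omega
  · have := slot_lt h ⟨m - 1, by omega⟩ j
    unfold slot at this ⊢
    dsimp only at this
    omega

theorem spine_eq (hm : 3 ≤ m) {i i' : Fin 3} {z : ℤ × ℤ}
    (h : z ∈ (fanPath.{u} hm (spine i)).points) (h' : z ∈ (fanPath.{u} hm (spine i')).points) :
    i = i' := by
  obtain ⟨k, h1, h2, rfl⟩ := (mem_spine hm).mp h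
  obtain ⟨k', h3, h4, h5⟩ := (mem_spine hm).mp h'
  obtain rfl := stair_injective h5
  by_contra hne
  rcases lt_or_gt_of_ne hne with h | h
  · have := slot_lt h ⟨m - 1, by omega⟩ (⟨0, by omega⟩ : Fin m)
    unfold slot at this
    dsimp only at this
    omega
  · have := slot_lt h ⟨m - 1, by omega⟩ (⟨0, by omega⟩ : Fin m)
    unfold slot at this
    dsimp only at this
    omega

theorem orient_spine {i : Fin 3} (j : Fin m) {k : ℕ} (hk : 10 * (2 * m * i) ≤ k) :
    (orient j = -1 ∧ slot i j % 2 = 0 ∧ 10 * slot i j ≤ k) ∨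
      (orient j = 1 ∧ slot i j % 2 = 1) ∨ (orient j = 0 ∧ slot i j % 2 = 0) := by
  have := orient_cases i j
  omega

theorem orient_pos (i : Fin 3) (j : Fin m) :
    (orient j = -1 ∧ slot i j % 2 = 0) ∨
      (orient j = 1 ∧ slot i j % 2 = 1) ∨ (orient j = 0 ∧ slot i j % 2 = 0 ∧ 0 < slot i j) := by
  have := orient_cases i j
  have h : orient j = 0 → 0 < slot i j := by
    unfold orient slot
    intro h
    split_ifs at h <;> omega
  omega

theorem fanPath_not_hub_spine (hm : 3 ≤ m) {i : Fin 3} {z : ℤ × ℤ}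
    (h : z ∈ (fanPath.{u} hm hub).points) (h' : z ∈ (fanPath.{u} hm (spine i)).points) :
    False := by
  obtain ⟨k, -, -, rfl⟩ := (mem_spine hm).mp h'
  exact not_hubBox_stair ((mem_hub hm).mp h)

theorem fanPath_not_hub_mid (hm : 3 ≤ m) {i : Fin 3} {j : Fin m} {z : ℤ × ℤ}
    (h : z ∈ (fanPath.{u} hm hub).points) (h' : z ∈ (fanPath.{u} hm (mid i j)).points) :
    False :=
  not_midBox_hubBox (orient_eq j) (stair_slot_sign i j) ((mem_mid hm).mp h')
    ((mem_hub hm).mp h)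

theorem fanPath_not_hub_link (hm : 3 ≤ m) {b : Bool} {i : Fin 3} {j : Fin m} {z : ℤ × ℤ}
    (h : z ∈ (fanPath.{u} hm hub).points) (h' : z ∈ (fanPath.{u} hm (link b i j)).points) :
    False :=
  not_linkBox_hubBox (orient_eq j) (stair_slot_sign i j) ((mem_link hm).mp h')
    ((mem_hub hm).mp h)

theorem fanPath_not_spine_link (hm : 3 ≤ m) {b : Bool} {i i' : Fin 3} {j : Fin m} {z : ℤ × ℤ}
    (h : z ∈ (fanPath.{u} hm (spine i')).points)
    (h' : z ∈ (fanPath.{u} hm (link b i j)).points) : False := by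
  obtain rfl := spine_eq_of_region hm h (region_link hm h')
  obtain ⟨k, h1, -, rfl⟩ := (mem_spine hm).mp h
  exact not_linkBox_stair (orient_spine j h1) ((mem_link hm).mp h')

theorem fanPath_arm_inj (hm : 3 ≤ m) {b b' : Bool} {i i' : Fin 3} {j j' : Fin m} {z : ℤ × ℤ}
    (h : z ∈ (fanPath.{u} hm (arm b i j)).points)
    (h' : z ∈ (fanPath.{u} hm (arm b' i' j')).points) :
    (arm b i j : FanVertex.{u} m) = arm b' i' j' := by
  obtain ⟨rfl, rfl⟩ := slot_eq_of_region hm (region_arm hm h) (region_arm hm h')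
  have h1 := (mem_arm hm).mp h
  have h2 := (mem_arm hm).mp h'
  rcases b <;> rcases b' <;> try rfl
  · exact (not_armBox_armBox (orient_eq j) (stair_slot_sign i j) h1 h2).elim
  · exact (not_armBox_armBox (orient_eq j) (stair_slot_sign i j) h2 h1).elim

theorem fanPath_link_inj (hm : 3 ≤ m) {b b' : Bool} {i i' : Fin 3} {j j' : Fin m} {z : ℤ × ℤ}
    (h : z ∈ (fanPath.{u} hm (link b i j)).points)
    (h' : z ∈ (fanPath.{u} hm (link b' i' j')).points) :
    (link b i j : FanVertex.{u} m) = link b' i' j' := by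
  obtain ⟨rfl, rfl⟩ := slot_eq_of_region hm (region_link hm h) (region_link hm h')
  have h1 := (mem_link hm).mp h
  have h2 := (mem_link hm).mp h'
  rcases b <;> rcases b' <;> try rfl
  · exact (not_linkBox_linkBox (orient_eq j) h1 h2).elim
  · exact (not_linkBox_linkBox (orient_eq j) h2 h1).elim

theorem fanPath_joined_of_link_arm (hm : 3 ≤ m) {b b' : Bool} {i i' : Fin 3} {j j' : Fin m}
    {z : ℤ × ℤ} (h : z ∈ (fanPath.{u} hm (link b i j)).points)
    (h' : z ∈ (fanPath.{u} hm (arm b' i' j')).points) :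
    Joined.{u} (link b i j) (arm b' i' j') := by
  obtain ⟨rfl, rfl⟩ := slot_eq_of_region hm (region_link hm h) (region_arm hm h')
  rcases eq_or_ne b' b with rfl | hb
  · exact .link_arm _ _ _
  · obtain rfl : b' = !b := Bool.eq_not.mpr hb
    exact (not_linkBox_armBox (orient_eq j) (stair_slot_sign i j) ((mem_link hm).mp h)
      ((mem_arm hm).mp h')).elim

theorem fanPath_touch (hm : 3 ≤ m) {v w : FanVertex.{u} m} (hvw : v ≠ w) {z : ℤ × ℤ}
    (h : z ∈ (fanPath hm v).points) (h' : z ∈ (fanPath hm w).points) : (fanGraph m).Adj v w := by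
  rw [fanGraph_adj]
  cases v with
  | hub =>
    cases w with
    | hub => exact (hvw rfl).elim
    | spine => exact (fanPath_not_hub_spine hm h h').elim
    | arm => exact Or.inr (.arm_hub _ _ _)
    | mid => exact (fanPath_not_hub_mid hm h h').elim
    | link => exact (fanPath_not_hub_link hm h h').elim
  | spine i =>
    cases w with
    | hub => exact (fanPath_not_hub_spine hm h' h).elim
    | spine i' => exact (hvw (congrArg _ (spine_eq hm h h'))).elim
    | arm b i' j =>
      obtain rfl := spine_eq_of_region hm h (region_arm hm h')
      exact Or.inr (.arm_spine _ _ _)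
    | mid i' j =>
      obtain rfl := spine_eq_of_region hm h (region_mid hm h')
      exact Or.inr (.mid_spine _ _)
    | link => exact (fanPath_not_spine_link hm h h').elim
  | arm b i j =>
    cases w with
    | hub => exact Or.inl (.arm_hub _ _ _)
    | spine i' =>
      obtain rfl := spine_eq_of_region hm h' (region_arm hm h)
      exact Or.inl (.arm_spine _ _ _)
    | arm => exact (hvw (fanPath_arm_inj hm h h')).elim
    | mid i' j' =>
      obtain ⟨rfl, rfl⟩ := slot_eq_of_region hm (region_arm hm h) (region_mid hm h')
      exact Or.inl (.arm_mid _ _ _)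
    | link => exact Or.inr (fanPath_joined_of_link_arm hm h' h)
  | mid i j =>
    cases w with
    | hub => exact (fanPath_not_hub_mid hm h' h).elim
    | spine i' =>
      obtain rfl := spine_eq_of_region hm h' (region_mid hm h)
      exact Or.inl (.mid_spine _ _)
    | arm b i' j' =>
      obtain ⟨rfl, rfl⟩ := slot_eq_of_region hm (region_mid hm h) (region_arm hm h')
      exact Or.inr (.arm_mid _ _ _)
    | mid i' j' =>
      obtain ⟨rfl, rfl⟩ := slot_eq_of_region hm (region_mid hm h) (region_mid hm h')
      exact (hvw rfl).elim
    | link b i' j' =>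
      obtain ⟨rfl, rfl⟩ := slot_eq_of_region hm (region_mid hm h) (region_link hm h')
      exact Or.inr (.link_mid _ _ _)
  | link b i j =>
    cases w with
    | hub => exact (fanPath_not_hub_link hm h' h).elim
    | spine => exact (fanPath_not_spine_link hm h' h).elim
    | arm => exact Or.inl (fanPath_joined_of_link_arm hm h h')
    | mid i' j' =>
      obtain ⟨rfl, rfl⟩ := slot_eq_of_region hm (region_link hm h) (region_mid hm h')
      exact Or.inl (.link_mid _ _ _)
    | link => exact (hvw (fanPath_link_inj hm h h')).elim

theorem Ell.meet_path {e e' : Ell} (h : ¬ (e.x₀ = e.x₁ ∧ e.y₀ = e.y₁))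
    (h' : ¬ (e'.x₀ = e'.x₁ ∧ e'.y₀ = e'.y₁))
    (H : ∃ x, (∀ z, e.On z → e'.On z → z = x) ∧ e.On x ∧ e'.On x ∧ (e.End x ∨ e'.End x)) :
    ∃ x, (∀ z, z ∈ (e.path h).points → z ∈ (e'.path h').points → z = x) ∧
      x ∈ (e.path h).points ∧ x ∈ (e'.path h').points ∧
        ((e.path h).IsEnd x ∨ (e'.path h').IsEnd x) := by
  obtain ⟨x, h1, h2, h3, h4⟩ := H
  exact ⟨x, fun z hz hz' => h1 z (Ell.mem_points_path.mp hz) (Ell.mem_points_path.mp hz'),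
    Ell.mem_points_path.mpr h2, Ell.mem_points_path.mpr h3,
    h4.imp Ell.isEnd_path Ell.isEnd_path⟩

theorem fanPath_meet (hm : 3 ≤ m) {v w : FanVertex.{u} m} (h : Joined v w) :
    ∃ x, (∀ z, z ∈ (fanPath hm v).points → z ∈ (fanPath hm w).points → z = x) ∧
      x ∈ (fanPath hm v).points ∧ x ∈ (fanPath hm w).points ∧
        ((fanPath hm v).IsEnd x ∨ (fanPath hm w).IsEnd x) := by
  cases h with
  | arm_hub b i j =>
    refine Ell.meet_path (armBox_ne b) hubBox_ne
      (armBox_meets_hubBox (orient_eq j) (stair_slot_sign i j) b ?_)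
    have h1 := stair_ten_mul (slot i j)
    have h2 := slot_lt_mul i j
    omega
  | arm_spine b i j =>
    have hj := j.2
    have h0 := orient_cases i j
    have h1 := armBox_stair (b := b) (orient_pos i j) rfl
    refine ⟨_, ?_, (mem_arm hm).mpr h1.2, (mem_spine hm).mpr ⟨_, ?_, ?_, rfl⟩,
      Or.inl (Ell.isEnd_path (h := armBox_ne b) h1.1)⟩
    · intro z hz hz'
      obtain ⟨k, h2, -, rfl⟩ := (mem_spine hm).mp hz'
      rw [eq_of_armBox_stair (orient_spine j h2) ((mem_arm hm).mp hz)]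
    -- A gadget of another orientation is not the first of its copy, so the point just before its
    -- corner is still on the spine.
    · have h3 : orient j ≠ -1 → 2 * m * i.1 < slot i j := by
        unfold orient slot
        split_ifs <;> omega
      have h4 : 2 * m * i.1 ≤ slot i j := Nat.le_add_right _ _
      split_ifs <;> omega
    · have h4 : slot i j ≤ 2 * m * i.1 + (m - 1) := by unfold slot; omega
      split_ifs <;> omega
  | mid_spine i j =>
    have hj := j.2
    have h1 := midBox_stair (slot i j) (orient j)
    refine ⟨_, ?_, (mem_mid hm).mpr h1.2, (mem_spine hm).mpr ⟨_, ?_, ?_, rfl⟩,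
      Or.inl (Ell.isEnd_path (h := midBox_ne) h1.1)⟩
    · intro z hz hz'
      obtain ⟨k, h2, -, rfl⟩ := (mem_spine hm).mp hz'
      rw [eq_of_midBox_stair (orient_spine j h2) ((mem_mid hm).mp hz)]
    · unfold slot
      omega
    · unfold slot
      omega
  | arm_mid b i j =>
    exact Ell.meet_path (armBox_ne b) midBox_ne
      (armBox_meets_midBox (orient_eq j) (stair_slot_sign i j) b)
  | link_mid b i j =>
    exact Ell.meet_path linkBox_ne midBox_ne
      (linkBox_meets_midBox (orient_eq j) b)
  | link_arm b i j =>
    exact Ell.meet_path linkBox_ne (armBox_ne b)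
      (linkBox_meets_armBox (orient_eq j) (stair_slot_sign i j) b)

/-- With `m = k + 3`, the gadgets occupy both ends and all corners of a spine of `m - 1` steps,
which has `m - 2 = k + 1` bends. -/
theorem isBCPG_fanGraph (k : ℕ) : IsBCPG (k + 1) (fanGraph.{u} (k + 3)) := by
  have hm : 3 ≤ k + 3 := by omega
  refine ⟨.mk' (fanPath hm) ?_ fun v w h hG z hv hw => hG (fanPath_touch hm h hv hw), ?_⟩
  · rintro v w (h | h)
    · exact fanPath_meet hm h
    · obtain ⟨x, h1, h2, h3, h4⟩ := fanPath_meet hm h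
      exact ⟨x, fun z hz hz' => h1 z hz' hz, h3, h2, h4.symm⟩
  · intro v
    have h1 : ∀ (e : Ell) (h), (e.path h).numBends ≤ k + 1 := fun e h =>
      (Ell.numBends_path_le (e := e) (h := h)).trans (by omega)
    cases v with
    | spine i => exact (numBends_stairPath_le (hn := by omega)).trans (by omega)
    | hub => exact h1 _ hubBox_ne
    | arm b => exact h1 _ (armBox_ne b)
    | mid => exact h1 _ midBox_ne
    | link => exact h1 _ linkBox_ne

/-! ### Planarity by a straight-line drawing -/

/-- The point that divides the segment from `a` to `b` in the ratio `t : 1 - t`. -/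
def segPt (a b : ℝ × ℝ) (t : ℝ) : ℝ × ℝ :=
  ((1 - t) * a.1 + t * b.1, (1 - t) * a.2 + t * b.2)

/-- A straight-line drawing without crossings shows that a graph is planar. -/
theorem isPlanar_of_straight {V : Type u} {G : SimpleGraph V} {E : V → V → Prop}
    (hE : ∀ v w, G.Adj v w ↔ E v w ∨ E w v) (pt : V → ℝ × ℝ) (hpt : Function.Injective pt)
    (h₁ : ∀ v w, E v w → ∀ t, 0 < t → t < 1 → ∀ x, segPt (pt v) (pt w) t ≠ pt x)
    (h₂ : ∀ v w v' w', E v w → E v' w' → ∀ t s, 0 < t → t < 1 → 0 < s → s < 1 →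
      segPt (pt v) (pt w) t = segPt (pt v') (pt w') s → v = v' ∧ w = w') : IsPlanar G := by
  have hor : ∀ e : G.edgeSet, ∃ p : V × V, E p.1 p.2 ∧ e.1 = s(p.1, p.2) := by
    rintro ⟨e, he⟩
    induction e with
    | _ v w =>
      rcases (hE v w).mp he with h | h
      · exact ⟨(v, w), h, rfl⟩
      · exact ⟨(w, v), h, Sym2.eq_swap⟩
  choose p hp hpe using hor
  have h0 : ∀ a b, segPt a b 0 = a := fun a b => by simp [segPt]
  have h1 : ∀ a b, segPt a b 1 = b := fun a b => by simp [segPt]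
  refine ⟨⟨pt, hpt, fun e => ⟨fun t => segPt (pt (p e).1) (pt (p e).2) t, ?_⟩, ?_, ?_, ?_⟩⟩
  · unfold segPt
    fun_prop
  · intro e t s hts
    have hne : pt (p e).1 ≠ pt (p e).2 := fun h => by
      have : G.Adj (p e).1 (p e).2 := (hE _ _).mpr (Or.inl (hp e))
      exact this.ne (hpt h)
    simp only [ContinuousMap.coe_mk, segPt, Prod.mk.injEq] at hts
    by_contra hne'
    have hts' : (t : ℝ) - s ≠ 0 := sub_ne_zero.mpr fun h => hne' (Subtype.ext h)
    refine hne (Prod.ext (mul_left_cancel₀ hts' ?_) (mul_left_cancel₀ hts' ?_))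
    · linear_combination -hts.1
    · linear_combination -hts.2
  · intro e
    simp only [ContinuousMap.coe_mk, Set.Icc.coe_zero, Set.Icc.coe_one, h0, h1, hpe e]
    ext z
    simp [eq_comm]
  · rintro e t ⟨ht0, ht1⟩
    have ht0' : (0 : ℝ) < t := ht0
    have ht1' : (t : ℝ) < 1 := ht1
    refine ⟨h₁ _ _ (hp e) t ht0' ht1', ?_⟩
    rintro e' hne ⟨s, hs⟩
    simp only [ContinuousMap.coe_mk] at hs
    rcases s.2.1.eq_or_lt with h | hs0
    · rw [← h, h0] at hs
      exact h₁ _ _ (hp e) t ht0' ht1' _ hs.symm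
    rcases s.2.2.eq_or_lt with h | hs1
    · rw [h, h1] at hs
      exact h₁ _ _ (hp e) t ht0' ht1' _ hs.symm
    have := h₂ _ _ _ _ (hp e) (hp e') t s ht0' ht1' hs0 hs1 hs.symm
    exact hne (Subtype.ext (by rw [hpe e, hpe e', this.1, this.2]))

/-- The second coordinates of the vertices of `fanGraph m` in a planar drawing. -/
def height : FanVertex.{u} m → ℕ
  | hub => 0
  | spine i => 12 * (2 * m * i)
  | arm b i j => 12 * slot i j + if b then 8 else 0
  | mid i j => 12 * slot i j + 4
  | link b i j => 12 * slot i j + if b then 6 else 2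

/-- The first coordinates of the vertices of `fanGraph m` in a planar drawing. -/
def abscissa : FanVertex.{u} m → ℤ
  | hub => 60 * m + 20
  | spine _ => -1
  | arm _ _ _ => 0
  | mid _ _ => 0
  | link _ _ _ => 1

/-- The points of a planar drawing of `fanGraph m`. -/
def fanPt (v : FanVertex.{u} m) : ℝ × ℝ := (abscissa v, height v)

theorem slot_inj {i i' : Fin 3} {j j' : Fin m} (h : slot i j = slot i' j') : i = i' ∧ j = j' := by
  obtain rfl : i = i' := by
    by_contra hne
    rcases lt_or_gt_of_ne hne with h' | h'
    · have := slot_lt h' j j'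
      omega
    · have := slot_lt h' j' j
      omega
  exact ⟨rfl, Fin.ext (by unfold slot at h; omega)⟩

theorem fanPt_injective (hm : 0 < m) : Function.Injective (fanPt.{u} (m := m)) := by
  intro v w h
  simp only [fanPt, Prod.mk.injEq, Int.cast_inj, Nat.cast_inj] at h
  obtain ⟨h1, h2⟩ := h
  rcases v with _ | i | ⟨b, i, j⟩ | ⟨i, j⟩ | ⟨b, i, j⟩ <;>
    rcases w with _ | i' | ⟨b', i', j'⟩ | ⟨i', j'⟩ | ⟨b', i', j'⟩ <;>
    simp only [abscissa, height] at h1 h2 <;> try omega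
  · rfl
  · have hi : 2 * m * i.1 = 2 * m * i'.1 := by omega
    exact congrArg _ (Fin.ext (Nat.eq_of_mul_eq_mul_left (by omega) hi))
  all_goals
    obtain ⟨rfl, rfl⟩ : i = i' ∧ j = j' := slot_inj (by (try split_ifs at h2) <;> omega)
    try rcases b
    all_goals try rcases b'
    all_goals simp at h2 ⊢

theorem slot_eq_of_mem_Ioo {s s' : ℕ} {y : ℝ} (h : 12 * (s : ℝ) < y) (h' : y < 12 * (s : ℝ) + 8)
    (k : 12 * (s' : ℝ) < y) (k' : y < 12 * (s' : ℝ) + 8) : s = s' := by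
  by_contra hne
  rcases lt_or_gt_of_ne hne with hl | hl
  · have : (s : ℝ) + 1 ≤ s' := by exact_mod_cast hl
    linarith
  · have : (s' : ℝ) + 1 ≤ s := by exact_mod_cast hl
    linarith

/-- The interior of the segment from `v` to a spine `w`. -/
def SpineEdge (v w : FanVertex.{u} m) (z : ℝ × ℝ) : Prop :=
  ∃ i, w = spine i ∧ ((∃ b j, v = arm b i j) ∨ ∃ j, v = mid i j) ∧ ∃ t, 0 < t ∧ t < 1 ∧
    z.1 = -t ∧ z.2 = (1 - t) * (height v : ℝ) + t * (height w : ℝ)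

/-- The interior of the segment from `v` to the hub `w`. -/
def HubEdge (v w : FanVertex.{u} m) (z : ℝ × ℝ) : Prop :=
  w = hub ∧ ∃ b i j, v = arm b i j ∧ ∃ t, 0 < t ∧ t < 1 ∧
    z.1 = t * (60 * m + 20) ∧ z.2 = (1 - t) * (height v : ℝ)

/-- The interior of the segment from an arm `v` to a middle vertex `w`. -/
def PathEdge (v w : FanVertex.{u} m) (z : ℝ × ℝ) : Prop :=
  ∃ b i j, v = arm b i j ∧ w = mid i j ∧ z.1 = 0 ∧
    ((b = false ∧ 12 * (slot i j : ℝ) < z.2 ∧ z.2 < 12 * (slot i j : ℝ) + 4) ∨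
      (b = true ∧ 12 * (slot i j : ℝ) + 4 < z.2 ∧ z.2 < 12 * (slot i j : ℝ) + 8))

/-- The interior of the segment from a link `v` to another vertex `w` of the same gadget. -/
def LinkEdge (v w : FanVertex.{u} m) (z : ℝ × ℝ) : Prop :=
  ∃ b i j, v = link b i j ∧ 0 < z.1 ∧ z.1 < 1 ∧
    ((b = false ∧ w = arm b i j ∧ z.2 = 12 * (slot i j : ℝ) + 2 * z.1) ∨
      (b = false ∧ w = mid i j ∧ z.2 = 12 * (slot i j : ℝ) + 4 - 2 * z.1) ∨
      (b = true ∧ w = mid i j ∧ z.2 = 12 * (slot i j : ℝ) + 4 + 2 * z.1) ∨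
      (b = true ∧ w = arm b i j ∧ z.2 = 12 * (slot i j : ℝ) + 8 - 2 * z.1))

/-- The first coordinate separates most of the four families: negative for spine edges, zero for
path edges, positive for hub and link edges. -/
theorem edge_cases {v w : FanVertex.{u} m} (h : Joined v w) {t : ℝ} (h0 : 0 < t) (h1 : t < 1) :
    SpineEdge v w (segPt (fanPt v) (fanPt w) t) ∨ HubEdge v w (segPt (fanPt v) (fanPt w) t) ∨
      PathEdge v w (segPt (fanPt v) (fanPt w) t) ∨
        LinkEdge v w (segPt (fanPt v) (fanPt w) t) := by
  cases h with
  | arm_hub b i j =>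
    exact Or.inr (Or.inl ⟨rfl, b, i, j, rfl, t, h0, h1, by simp [segPt, fanPt, abscissa],
      by simp [segPt, fanPt, height]⟩)
  | arm_spine b i j =>
    exact Or.inl ⟨i, rfl, Or.inl ⟨b, j, rfl⟩, t, h0, h1, by simp [segPt, fanPt, abscissa], rfl⟩
  | mid_spine i j =>
    exact Or.inl ⟨i, rfl, Or.inr ⟨j, rfl⟩, t, h0, h1, by simp [segPt, fanPt, abscissa], rfl⟩
  | arm_mid b i j =>
    refine Or.inr (Or.inr (Or.inl ⟨b, i, j, rfl, rfl, by simp [segPt, fanPt, abscissa], ?_⟩))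
    rcases b <;> simp [segPt, fanPt, height] <;> constructor <;> linarith
  | link_mid b i j =>
    refine Or.inr (Or.inr (Or.inr ⟨b, i, j, rfl, by simpa [segPt, fanPt, abscissa],
      by simpa [segPt, fanPt, abscissa], ?_⟩))
    rcases b <;> simp [segPt, fanPt, height, abscissa] <;> ring
  | link_arm b i j =>
    refine Or.inr (Or.inr (Or.inr ⟨b, i, j, rfl, by simpa [segPt, fanPt, abscissa],
      by simpa [segPt, fanPt, abscissa], ?_⟩))
    rcases b <;> simp [segPt, fanPt, height, abscissa] <;> ring

theorem LinkEdge.bounds {v w : FanVertex.{u} m} {z : ℝ × ℝ} (h : LinkEdge v w z) :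
    0 < z.1 ∧ z.1 < 1 ∧ ∃ b i j, v = link b i j ∧ 12 * (slot i j : ℝ) < z.2 ∧
      z.2 < 12 * (slot i j : ℝ) + 8 - z.1 := by
  obtain ⟨b, i, j, rfl, h0, h1, h | h | h | h⟩ := h <;>
    exact ⟨h0, h1, b, i, j, rfl, by linarith, by linarith⟩

/-- Since slots are below `5 * m`, arms have height less than `60 * m + 20`, the abscissa of the
hub. So hub edges have slope greater than `-1` and drop by at most `z.1`. -/
theorem HubEdge.bounds {v w : FanVertex.{u} m} {z : ℝ × ℝ} (h : HubEdge v w z) :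
    0 < z.1 ∧ z.1 < 60 * m + 20 ∧ ∃ b i j, v = arm b i j ∧
      ((b = false ∧ 12 * (slot i j : ℝ) - z.1 ≤ z.2 ∧ z.2 ≤ 12 * (slot i j : ℝ)) ∨
        (b = true ∧ 12 * (slot i j : ℝ) + 8 - z.1 ≤ z.2 ∧ z.2 ≤ 12 * (slot i j : ℝ) + 8)) := by
  obtain ⟨rfl, b, i, j, rfl, t, h0, h1, hx, hy⟩ := h
  have hs : (slot i j : ℝ) + 1 ≤ 5 * m := by exact_mod_cast slot_lt_mul i j
  have hs0 : (0 : ℝ) ≤ slot i j := Nat.cast_nonneg _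
  have hm : (0 : ℝ) ≤ m := Nat.cast_nonneg _
  refine ⟨by rw [hx]; positivity, by rw [hx]; nlinarith, b, i, j, rfl, ?_⟩
  rcases b <;> simp only [height, Bool.false_eq_true, if_true, if_false] at hy <;>
    push_cast at hy <;> simp <;> constructor <;> nlinarith

theorem SpineEdge.eq {v w v' w' : FanVertex.{u} m} {z : ℝ × ℝ} (h : SpineEdge v w z)
    (h' : SpineEdge v' w' z) : v = v' ∧ w = w' := by
  -- On both sides of the strip the copies are stacked in the same order, so edges to different
  -- spines do not cross.
  have lt_of_lt : ∀ {i i' : Fin 3} {v v' : FanVertex.{u} m}, i < i' →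
      ((∃ b j, v = arm b i j) ∨ ∃ j, v = mid i j) →
      ((∃ b j, v' = arm b i' j) ∨ ∃ j, v' = mid i' j) →
      height v < height v' ∧
        height (spine i : FanVertex.{u} m) ≤ height (spine i' : FanVertex.{u} m) := by
    intro i i' v v' hi hv hv'
    refine ⟨?_, Nat.mul_le_mul_left _ (Nat.mul_le_mul_left _ hi.le)⟩
    rcases hv with ⟨b, j, rfl⟩ | ⟨j, rfl⟩ <;> rcases hv' with ⟨b', j', rfl⟩ | ⟨j', rfl⟩ <;>
      have := slot_lt hi j j' <;> simp only [height] <;> (try split_ifs) <;> omega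
  have aux : ∀ {t a b c d : ℝ}, 0 < t → t < 1 → a < b → c ≤ d →
      (1 - t) * a + t * c ≠ (1 - t) * b + t * d := by
    intro t a b c d h0 h1 hab hcd h
    have := mul_pos (sub_pos.mpr h1) (sub_pos.mpr hab)
    have := mul_nonneg h0.le (sub_nonneg.mpr hcd)
    linarith
  obtain ⟨i, rfl, hv, t, h0, h1, hx, hy⟩ := h
  obtain ⟨i', rfl, hv', t', -, -, hx', hy'⟩ := h'
  obtain rfl : t = t' := by linarith
  rw [hy] at hy'
  rcases lt_trichotomy i i' with hi | rfl | hi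
  · obtain ⟨h2, h3⟩ := lt_of_lt hi hv hv'
    exact (aux h0 h1 (by exact_mod_cast h2) (by exact_mod_cast h3) hy').elim
  · refine ⟨?_, rfl⟩
    have h2 : (height v : ℝ) = height v' :=
      mul_left_cancel₀ (sub_pos.mpr h1).ne' (by linarith)
    have hm : 0 < m := by rcases hv with ⟨-, j, -⟩ | ⟨j, -⟩ <;> exact j.pos
    refine fanPt_injective hm (Prod.ext ?_ h2)
    rcases hv with ⟨b, j, rfl⟩ | ⟨j, rfl⟩ <;> rcases hv' with ⟨b', j', rfl⟩ | ⟨j', rfl⟩ <;> rfl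
  · obtain ⟨h2, h3⟩ := lt_of_lt hi hv' hv
    exact (aux h0 h1 (by exact_mod_cast h2) (by exact_mod_cast h3) hy'.symm).elim

theorem HubEdge.eq {v w v' w' : FanVertex.{u} m} {z : ℝ × ℝ} (h : HubEdge v w z)
    (h' : HubEdge v' w' z) : v = v' ∧ w = w' := by
  obtain ⟨rfl, b, i, j, rfl, t, h0, h1, hx, hy⟩ := h
  obtain ⟨rfl, b', i', j', rfl, t', -, -, hx', hy'⟩ := h'
  have hK : (60 * m + 20 : ℝ) ≠ 0 := by positivity
  obtain rfl : t = t' := mul_right_cancel₀ hK (hx.symm.trans hx')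
  refine ⟨fanPt_injective j.pos (Prod.ext rfl ?_), rfl⟩
  exact mul_left_cancel₀ (sub_pos.mpr h1).ne' (hy.symm.trans hy')

theorem PathEdge.eq {v w v' w' : FanVertex.{u} m} {z : ℝ × ℝ} (h : PathEdge v w z)
    (h' : PathEdge v' w' z) : v = v' ∧ w = w' := by
  obtain ⟨b, i, j, rfl, rfl, -, h⟩ := h
  obtain ⟨b', i', j', rfl, rfl, -, h'⟩ := h'
  obtain ⟨rfl, rfl⟩ : i = i' ∧ j = j' := by
    refine slot_inj (slot_eq_of_mem_Ioo (y := z.2) ?_ ?_ ?_ ?_)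
    · rcases h with h | h <;> linarith
    · rcases h with h | h <;> linarith
    · rcases h' with h' | h' <;> linarith
    · rcases h' with h' | h' <;> linarith
  rcases h with ⟨rfl, h⟩ | ⟨rfl, h⟩ <;> rcases h' with ⟨rfl, h'⟩ | ⟨rfl, h'⟩ <;>
    first | exact ⟨rfl, rfl⟩ | (exfalso; linarith)

theorem LinkEdge.eq {v w v' w' : FanVertex.{u} m} {z : ℝ × ℝ} (h : LinkEdge v w z)
    (h' : LinkEdge v' w' z) : v = v' ∧ w = w' := by
  obtain ⟨h0, h1, b, i, j, rfl, h2, h3⟩ := h.bounds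
  obtain ⟨-, -, b', i', j', rfl, h2', h3'⟩ := h'.bounds
  obtain ⟨rfl, rfl⟩ : i = i' ∧ j = j' :=
    slot_inj (slot_eq_of_mem_Ioo h2 (by linarith) h2' (by linarith))
  obtain ⟨b, i, j, e, -, -, h⟩ := h
  cases e
  obtain ⟨b', i, j, e, -, -, h'⟩ := h'
  cases e
  rcases h with ⟨rfl, rfl, h⟩ | ⟨rfl, rfl, h⟩ | ⟨rfl, rfl, h⟩ | ⟨rfl, rfl, h⟩ <;>
    rcases h' with ⟨rfl, rfl, h'⟩ | ⟨rfl, rfl, h'⟩ | ⟨rfl, rfl, h'⟩ | ⟨rfl, rfl, h'⟩ <;>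
    first | exact ⟨rfl, rfl⟩ | (exfalso; linarith)

/-- At abscissa `z.1` the link edges of a gadget lie strictly between its first arm's height and its
second arm's height minus `z.1`, and the bound on the slope keeps all hub edges out of this band. -/
theorem HubEdge.not_linkEdge {v w v' w' : FanVertex.{u} m} {z : ℝ × ℝ} (h : HubEdge v w z)
    (h' : LinkEdge v' w' z) : False := by
  obtain ⟨h0, -, b, i, j, -, h⟩ := h.bounds
  obtain ⟨-, h1, b', i', j', -, h2, h3⟩ := h'.bounds
  rcases lt_trichotomy (slot i j) (slot i' j') with hs | hs | hs
  · have : (slot i j : ℝ) + 1 ≤ slot i' j' := by exact_mod_cast hs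
    rcases h with h | h <;> linarith
  · rw [hs] at h
    rcases h with h | h <;> linarith
  · have : (slot i' j' : ℝ) + 1 ≤ slot i j := by exact_mod_cast hs
    rcases h with h | h <;> linarith

theorem SpineEdge.fst_neg {v w : FanVertex.{u} m} {z : ℝ × ℝ} (h : SpineEdge v w z) :
    -1 < z.1 ∧ z.1 < 0 := by
  obtain ⟨i, -, -, t, h0, h1, hx, -⟩ := h
  constructor <;> linarith

theorem PathEdge.fst_eq {v w : FanVertex.{u} m} {z : ℝ × ℝ} (h : PathEdge v w z) : z.1 = 0 := by
  obtain ⟨b, i, j, -, -, h, -⟩ := h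
  exact h

theorem HubEdge.ne_fanPt {v w : FanVertex.{u} m} {z : ℝ × ℝ} (h : HubEdge v w z)
    (x : FanVertex.{u} m) : z ≠ fanPt x := by
  rintro rfl
  obtain ⟨h0, h1, b, i, j, -, h⟩ := h.bounds
  cases x with
  | hub => simp [fanPt, abscissa] at h1
  | spine => norm_num [fanPt, abscissa] at h0
  | arm => simp [fanPt, abscissa] at h0
  | mid => simp [fanPt, abscissa] at h0
  | link b' i' j' =>
    simp only [fanPt, abscissa, height, Int.cast_one] at h
    rcases lt_trichotomy (slot i j) (slot i' j') with hs | hs | hs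
    · have : (slot i j : ℝ) + 1 ≤ slot i' j' := by exact_mod_cast hs
      rcases h with h | h <;> split_ifs at h <;> push_cast at h <;> linarith
    · rw [hs] at h
      rcases h with h | h <;> split_ifs at h <;> push_cast at h <;> linarith
    · have : (slot i' j' : ℝ) + 1 ≤ slot i j := by exact_mod_cast hs
      rcases h with h | h <;> split_ifs at h <;> push_cast at h <;> linarith

theorem PathEdge.ne_fanPt {v w : FanVertex.{u} m} {z : ℝ × ℝ} (h : PathEdge v w z)
    (x : FanVertex.{u} m) : z ≠ fanPt x := by
  rintro rfl
  obtain ⟨b, i, j, -, -, h0, h⟩ := h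
  have key : ∀ i' j', (height x : ℝ) = 12 * slot (m := m) i' j' ∨
      (height x : ℝ) = 12 * slot (m := m) i' j' + 4 ∨
      (height x : ℝ) = 12 * slot (m := m) i' j' + 8 → False := by
    intro i' j' hx
    simp only [fanPt] at h
    rcases lt_trichotomy (slot i j) (slot i' j') with hs | hs | hs
    · have : (slot i j : ℝ) + 1 ≤ slot i' j' := by exact_mod_cast hs
      rcases h with h | h <;> rcases hx with hx | hx | hx <;> linarith
    · rw [hs] at h
      rcases h with h | h <;> rcases hx with hx | hx | hx <;> linarith
    · have : (slot i' j' : ℝ) + 1 ≤ slot i j := by exact_mod_cast hs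
      rcases h with h | h <;> rcases hx with hx | hx | hx <;> linarith
  cases x with
  | hub =>
    simp only [fanPt, abscissa] at h0
    push_cast at h0
    have : (0 : ℝ) ≤ m := Nat.cast_nonneg _
    linarith
  | spine => norm_num [fanPt, abscissa] at h0
  | arm b' i' j' => exact key i' j' (by rcases b' <;> simp [height])
  | mid i' j' => exact key i' j' (by simp [height])
  | link => norm_num [fanPt, abscissa] at h0

theorem fanPt_fst_of_mem_Ioo {x : FanVertex.{u} m} (h0 : -1 < (fanPt x).1) (h1 : (fanPt x).1 < 1) :
    (fanPt x).1 = 0 := by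
  have hm : (0 : ℝ) ≤ m := Nat.cast_nonneg _
  cases x <;> simp [fanPt, abscissa] at h0 h1 ⊢
  linarith

theorem isPlanar_fanGraph (hm : 0 < m) : IsPlanar (fanGraph.{u} m) := by
  refine isPlanar_of_straight (fun v w => fanGraph_adj) fanPt (fanPt_injective hm) ?_ ?_
  · intro v w h t h0 h1 x hx
    rcases edge_cases h h0 h1 with h | h | h | h
    · rw [hx] at h
      have := fanPt_fst_of_mem_Ioo h.fst_neg.1 (by linarith [h.fst_neg.2])
      linarith [h.fst_neg.2]
    · exact h.ne_fanPt x hx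
    · exact h.ne_fanPt x hx
    · rw [hx] at h
      have := fanPt_fst_of_mem_Ioo (by linarith [h.bounds.1]) h.bounds.2.1
      linarith [h.bounds.1]
  · intro v w v' w' h h' t s h0 h1 h0' h1' hz
    have k := edge_cases h h0 h1
    have k' := edge_cases h' h0' h1'
    rw [← hz] at k'
    rcases k with k | k | k | k <;> rcases k' with k' | k' | k' | k'
    · exact k.eq k'
    · linarith [k.fst_neg.2, k'.bounds.1]
    · linarith [k.fst_neg.2, k'.fst_eq]
    · linarith [k.fst_neg.2, k'.bounds.1]
    · linarith [k'.fst_neg.2, k.bounds.1]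
    · exact k.eq k'
    · linarith [k'.fst_eq, k.bounds.1]
    · exact (k.not_linkEdge k').elim
    · linarith [k'.fst_neg.2, k.fst_eq]
    · linarith [k.fst_eq, k'.bounds.1]
    · exact k.eq k'
    · linarith [k.fst_eq, k'.bounds.1]
    · linarith [k'.fst_neg.2, k.bounds.1]
    · exact (k'.not_linkEdge k).elim
    · linarith [k'.fst_eq, k.bounds.1]
    · exact k.eq k'

/-- A planar graph that separates the classes. -/
def fanFinGraph (k : ℕ) : FinGraph.{u} := ⟨FanVertex.{u} (k + 3), FanVertex.finite _, fanGraph _⟩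

theorem BCPG_mono (k : ℕ) : BCPG.{u} k ⊆ BCPG.{u} (k + 1) :=
  fun _ ⟨R, hR⟩ => ⟨R, fun v => (hR v).trans (Nat.le_succ k)⟩

theorem fanFinGraph_mem (k : ℕ) : fanFinGraph.{u} k ∈ BCPG.{u} (k + 1) := isBCPG_fanGraph k

theorem fanFinGraph_notMem (k : ℕ) : fanFinGraph.{u} k ∉ BCPG.{u} k := not_isBCPG_fanGraph k

theorem fanFinGraph_planar (k : ℕ) : fanFinGraph.{u} k ∈ Planar.{u} :=
  isPlanar_fanGraph (Nat.succ_pos _)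

end CPG

theorem mainTheorem2 (k : ℕ) :
    CPG.BCPG.{u} k ⊂ CPG.BCPG.{u} (k + 1) ∧
      CPG.BCPG.{u} k ∩ CPG.Planar.{u} ⊂ CPG.BCPG.{u} (k + 1) ∩ CPG.Planar.{u} := by
  refine ⟨⟨CPG.BCPG_mono k, fun h => ?_⟩,
    ⟨Set.inter_subset_inter_left _ (CPG.BCPG_mono k), fun h => ?_⟩⟩
  · exact CPG.fanFinGraph_notMem k (h (CPG.fanFinGraph_mem k))
  · exact CPG.fanFinGraph_notMem k (h ⟨CPG.fanFinGraph_mem k, CPG.fanFinGraph_planar k⟩).1
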